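/- All logarithms are to base 2. Let $\mathcal X_1,\mathcal X_2$ be finite sets, let $p_{X_1X_2}$ and $p_{K_1K_2}$ be probability distributions on $\mathcal X_1\times\mathcal X_2$, and let $\delta_0>0$. For each $n$ let the source pair $(\boldsymbol X_1,\boldsymbol X_2)$ have law $p_{X_1X_2}^n$ and let the key pair $(\boldsymbol K_1,\boldsymbol K_2)$, independent of the sources, have law $p_{K_1K_2}^n$. A distributed source encryption system of length $n$ consists of encryption functions $\Phi_i:\mathcal X_i^n\times\mathcal X_i^n\to\mathcal C_i$ ($i=1,2$; key first, plaintext second; $\mathcal C_i$ finite) and a decryption function $\Psi:\mathcal X_1^n\times\mathcal X_2^n\times\mathcal C_1\times\mathcal C_2\to\mathcal X_1^n\times\mathcal X_2^n$ for which there is a distributed source code $\phi_i:\mathcal X_i^n\to\mathcal M_i$ ($\mathcal M_i$ finite), $\psi:\mathcal M_1\times\mathcal M_2\to\mathcal X_1^n\times\mathcal X_2^n$ such that, for all keys $(\boldsymbol k_1,\boldsymbol k_2)$ and all $(\boldsymbol x_1,\boldsymbol x_2)$, $$\Psi(\boldsymbol k_1,\boldsymbol k_2,\Phi_1(\boldsymbol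 k_1,\boldsymbol x_1),\Phi_2(\boldsymbol k_2,\boldsymbol x_2))=\psi(\phi_1(\boldsymbol x_1),\phi_2(\boldsymbol x_2)).$$ Its error probability is $p_{\rm e}=\Pr[\psi(\phi_1(\boldsymbol X_1),\phi_2(\boldsymbol X_2))\ne(\boldsymbol X_1,\boldsymbol X_2)]$, and its leakage is the mutual information $I(C_1C_2;\boldsymbol X_1\boldsymbol X_2)$, where $C_i=\Phi_i(\boldsymbol K_i,\boldsymbol X_i)$. For $\varepsilon\in(0,1)$ and $\delta\in[0,\delta_0]$ let $\mathcal R^*(\varepsilon,\delta|p_{X_1X_2},p_{K_1K_2})$ be the set of $(R_1,R_2)\in\mathbb R^2$ for which there is a sequence of such systems, one for each $n$, such that for every $\gamma>0$ there is $n_0$ with, for all $n\ge n_0$, $$\tfrac1n\log|\mathcal C_i^{(n)}|\le R_i+\gamma\ (i=1,2),\qquad p_{\rm e}\le\varepsilon,\qquad I(C_1^{(n)}C_2^{(n)};\boldsymbol X_1\boldsymbol X_2)\le\delta.$$ Let $\mathcal R^*(p_{X_1X_2},p_{K_1K_2})$ be the intersection of these sets over $(\varepsilon,\delta)\in(0,1)\times(0,\delta_0]$.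 Let $$\mathcal R_{\rm sw}(p_{X_1X_2})=\{R_1\ge H(X_1|X_2),\ R_2\ge H(X_2|X_1),\ R_1+R_2\ge H(X_1X_2)\},$$ $$\mathcal R_{\rm key}(p_{K_1K_2})=\{R_1\le H(K_1),\ R_2\le H(K_2),\ R_1+R_2\le H(K_1K_2)\},$$ and let $\mathcal R(p_{X_1X_2},p_{K_1K_2})$ be the set of all $(R_1,R_2)$ with $R_i\ge\widetilde R_i$ ($i=1,2$) for some $(\widetilde R_1,\widetilde R_2)\in\mathcal R_{\rm key}(p_{K_1K_2})\cap\mathcal R_{\rm sw}(p_{X_1X_2})$. Let $\mathcal S(p_{X_1X_2},p_{K_1K_2})$, $\mathcal S_{\rm sw}(p_{X_1X_2})$, $\mathcal S^*(p_{X_1X_2},p_{K_1K_2})$ and $\mathcal S^*(\varepsilon,\delta|p_{X_1X_2},p_{K_1K_2})$ be the intersections of $\mathcal R$, $\mathcal R_{\rm sw}$, $\mathcal R^*$ and $\mathcal R^*(\varepsilon,\delta|\cdot)$, respectively, with the line $\{R_1+R_2=H(X_1X_2)\}$. **Theorem.** For all $p_{X_1X_2}$ and $p_{K_1K_2}$,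 $$\mathcal S(p_{X_1X_2},p_{K_1K_2})=\mathcal S_{\rm sw}(p_{X_1X_2})\cap\mathcal R_{\rm key}(p_{K_1K_2}),$$ and (strong converse) for all $\varepsilon\in(0,1)$ and $\delta\in[0,\delta_0]$ $$\mathcal S^*(\varepsilon,\delta|p_{X_1X_2},p_{K_1K_2})\subseteq\mathcal S(p_{X_1X_2},p_{K_1K_2}),\qquad \mathcal S^*(p_{X_1X_2},p_{K_1K_2})\subseteq\mathcal S(p_{X_1X_2},p_{K_1K_2}).$$ If, moreover, none of the three equalities $H(X_1|X_2)=H(K_1)$, $H(X_2|X_1)=H(K_2)$, $H(X_1X_2)=H(K_1K_2)$ holds with a nonzero common value, then for all $\varepsilon\in(0,1)$ and $\delta\in(0,\delta_0]$ $$\mathcal S(p_{X_1X_2},p_{K_1K_2})=\mathcal S_{\rm sw}(p_{X_1X_2})\cap\mathcal R_{\rm key}(p_{K_1K_2})=\mathcal S^*(p_{X_1X_2},p_{K_1K_2})=\mathcal S^*(\varepsilon,\delta|p_{X_1X_2},p_{K_1K_2}).$$ -/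

import Mathlib

noncomputable section

namespace DistEnc

/-! Distributions on a finite set are real functions in `stdSimplex ℝ _`; logarithms have base 2. -/

/-- Shannon entropy `H(p)` in bits. -/
def entropy {α : Type*} [Fintype α] (p : α → ℝ) : ℝ :=
  -∑ a, p a * Real.logb 2 (p a)

/-- First marginal of a joint distribution. -/
def marg₁ {α β : Type*} [Fintype β] (p : α × β → ℝ) (a : α) : ℝ := ∑ b, p (a, b)

/-- Second marginal of a joint distribution. -/
def marg₂ {α β : Type*} [Fintype α] (p : α × β → ℝ) (b : β) : ℝ := ∑ a, p (a, b)

/-- Conditional entropy `H(first | second)` in bits. -/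
def condEntropy₁ {α β : Type*} [Fintype α] [Fintype β] (p : α × β → ℝ) : ℝ :=
  -∑ z, p z * Real.logb 2 (p z / marg₂ p z.2)

/-- Conditional entropy `H(second | first)` in bits. -/
def condEntropy₂ {α β : Type*} [Fintype α] [Fintype β] (p : α × β → ℝ) : ℝ :=
  -∑ z, p z * Real.logb 2 (p z / marg₁ p z.1)

/-- Mutual information (in bits) between the two components of a joint distribution. -/
def mutualInfo {α β : Type*} [Fintype α] [Fintype β] (p : α × β → ℝ) : ℝ :=
  ∑ z, p z * Real.logb 2 (p z / (marg₁ p z.1 * marg₂ p z.2))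

section Systems

variable {A₁ A₂ : Type*}

/-- Memoryless extension: `pⁿ(x₁, x₂) = ∏ₜ p(x₁ₜ, x₂ₜ)`. -/
def iid (p : A₁ × A₂ → ℝ) (n : ℕ) (x : (Fin n → A₁) × (Fin n → A₂)) : ℝ :=
  ∏ t, p (x.1 t, x.2 t)

/-- A distributed source code `(φ₁, φ₂, ψ)` of block length `n`. The finite message sets are
represented, up to bijection, by `Fin M₁` and `Fin M₂`. -/
structure SourceCode (A₁ A₂ : Type*) (n : ℕ) where
  M₁ : ℕ
  M₂ : ℕ
  φ₁ : (Fin n → A₁) → Fin M₁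
  φ₂ : (Fin n → A₂) → Fin M₂
  ψ : Fin M₁ → Fin M₂ → (Fin n → A₁) × (Fin n → A₂)

/-- The set of correctly decoded pairs of words. -/
def SourceCode.correct {n : ℕ} (S : SourceCode A₁ A₂ n) : Set ((Fin n → A₁) × (Fin n → A₂)) :=
  {x | S.ψ (S.φ₁ x.1) (S.φ₂ x.2) = x}

open Classical in
/-- The decoding error probability: the probability that the source pair is not decoded
correctly. -/
def SourceCode.errorProb [Fintype A₁] [Fintype A₂] {n : ℕ} (S : SourceCode A₁ A₂ n)
    (pX : A₁ × A₂ → ℝ) : ℝ :=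
  ∑ x, if x ∈ S.correct then 0 else iid pX n x

/-- A triple `(Φ₁, Φ₂, Ψ)` of encryption functions (key first, plaintext second) and a
decryption function (keys first, ciphertexts second). The finite ciphertext sets are represented,
up to bijection, by `Fin C₁` and `Fin C₂`. -/
structure Cryptosystem (A₁ A₂ : Type*) (n : ℕ) where
  C₁ : ℕ
  C₂ : ℕ
  Φ₁ : (Fin n → A₁) → (Fin n → A₁) → Fin C₁
  Φ₂ : (Fin n → A₂) → (Fin n → A₂) → Fin C₂
  Ψ : (Fin n → A₁) → (Fin n → A₂) → Fin C₁ → Fin C₂ → (Fin n → A₁) × (Fin n → A₂)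

/-- Encryption followed by decryption acts as the source code `S`, whatever the keys are. -/
def Cryptosystem.ActsAs {n : ℕ} (E : Cryptosystem A₁ A₂ n) (S : SourceCode A₁ A₂ n) : Prop :=
  ∀ (k₁ : Fin n → A₁) (k₂ : Fin n → A₂) (x₁ : Fin n → A₁) (x₂ : Fin n → A₂),
    E.Ψ k₁ k₂ (E.Φ₁ k₁ x₁) (E.Φ₂ k₂ x₂) = S.ψ (S.φ₁ x₁) (S.φ₂ x₂)

variable [Fintype A₁] [Fintype A₂]

/-- The joint law of the ciphertexts `(C₁, C₂)` and the sources `(X₁, X₂)` when the keys are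
independent of the sources. -/
def Cryptosystem.cipherSourceLaw {n : ℕ} (E : Cryptosystem A₁ A₂ n) (pX pK : A₁ × A₂ → ℝ) :
    (Fin E.C₁ × Fin E.C₂) × ((Fin n → A₁) × (Fin n → A₂)) → ℝ :=
  open Classical in
  fun z => ∑ k : (Fin n → A₁) × (Fin n → A₂),
    if E.Φ₁ k.1 z.2.1 = z.1.1 ∧ E.Φ₂ k.2 z.2.2 = z.1.2 then iid pX n z.2 * iid pK n k else 0

/-- The information leakage `I(C₁ C₂ ; X₁ X₂)` in bits. -/
def Cryptosystem.leakage {n : ℕ} (E : Cryptosystem A₁ A₂ n) (pX pK : A₁ × A₂ → ℝ) : ℝ :=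
  mutualInfo (E.cipherSourceLaw pX pK)

/-- `(R₁, R₂)` is an `(ε, δ)`-reliable and secure rate pair. -/
def IsReliableSecure (ε δ : ℝ) (pX pK : A₁ × A₂ → ℝ) (R : ℝ × ℝ) : Prop :=
  ∃ (E : ∀ n, Cryptosystem A₁ A₂ n) (S : ∀ n, SourceCode A₁ A₂ n),
    (∀ n, (E n).ActsAs (S n)) ∧
    ∀ γ : ℝ, 0 < γ → ∃ n₀ : ℕ, 1 ≤ n₀ ∧ ∀ n : ℕ, n₀ ≤ n →
      1 / (n : ℝ) * Real.logb 2 (E n).C₁ ≤ R.1 + γ ∧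
      1 / (n : ℝ) * Real.logb 2 (E n).C₂ ≤ R.2 + γ ∧
      (S n).errorProb pX ≤ ε ∧
      (E n).leakage pX pK ≤ δ

/-- The `(ε, δ)`-reliable and secure rate region `R*(ε, δ | pX, pK)`. -/
def regionStarAt (ε δ : ℝ) (pX pK : A₁ × A₂ → ℝ) : Set (ℝ × ℝ) :=
  {R | IsReliableSecure ε δ pX pK R}

/-- The reliable and secure rate region `R*(pX, pK)`. -/
def regionStar (δ₀ : ℝ) (pX pK : A₁ × A₂ → ℝ) : Set (ℝ × ℝ) :=
  {R | ∀ ε ∈ Set.Ioo (0 : ℝ) 1, ∀ δ ∈ Set.Ioc (0 : ℝ) δ₀, R ∈ regionStarAt ε δ pX pK}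

/-- The Slepian–Wolf region. -/
def regionSW (pX : A₁ × A₂ → ℝ) : Set (ℝ × ℝ) :=
  {R | condEntropy₁ pX ≤ R.1 ∧ condEntropy₂ pX ≤ R.2 ∧ entropy pX ≤ R.1 + R.2}

/-- The key region. -/
def regionKey (pK : A₁ × A₂ → ℝ) : Set (ℝ × ℝ) :=
  {R | R.1 ≤ entropy (marg₁ pK) ∧ R.2 ≤ entropy (marg₂ pK) ∧ R.1 + R.2 ≤ entropy pK}

/-- The region `R(pX, pK)`: all rate pairs that dominate a point of the intersection of the key
region and the Slepian–Wolf region. -/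
def region (pX pK : A₁ × A₂ → ℝ) : Set (ℝ × ℝ) :=
  {R | ∃ R' ∈ regionKey pK ∩ regionSW pX, R'.1 ≤ R.1 ∧ R'.2 ≤ R.2}

/-- The sum-rate line `R₁ + R₂ = H(X₁ X₂)`. -/
def sumLine (pX : A₁ × A₂ → ℝ) : Set (ℝ × ℝ) := {R | R.1 + R.2 = entropy pX}

/-- `S(pX, pK)`. -/
def sumSet (pX pK : A₁ × A₂ → ℝ) : Set (ℝ × ℝ) := region pX pK ∩ sumLine pX

/-- `S_sw(pX)`. -/
def sumSetSW (pX : A₁ × A₂ → ℝ) : Set (ℝ × ℝ) := regionSW pX ∩ sumLine pX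

/-- `S*(ε, δ | pX, pK)`. -/
def sumSetStarAt (ε δ : ℝ) (pX pK : A₁ × A₂ → ℝ) : Set (ℝ × ℝ) :=
  regionStarAt ε δ pX pK ∩ sumLine pX

/-- `S*(pX, pK)`. -/
def sumSetStar (δ₀ : ℝ) (pX pK : A₁ × A₂ → ℝ) : Set (ℝ × ℝ) :=
  regionStar δ₀ pX pK ∩ sumLine pX

end Systems

end DistEnc

end

/-!
The statement is about the rate pairs `R` on the sum-rate line `R.1 + R.2 = H(X₁ X₂)`. A point of
the Slepian–Wolf region dominated by such an `R` is `R` itself, which gives the first equality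
(`sumSet_eq`). The rest is a strong converse and a random coding argument. All asymptotics come from
one estimate: if `∑ z, p z * log (g z) < 0`, then `∑ z, p z * g z ^ s < 1` for some `s ∈ (0, 1]`
(`exists_sum_mul_rpow_lt_one`), hence the `s`-th moment of the product of the `g zₜ` over `n`
independent letters is exponentially small.

**Converse.** The only consequence of small leakage that is used is a change of measure
(`exp_le_prod_prob_of_mutualInfo_le`): an event whose probability is bounded below keeps a
probability bounded below when the ciphertext and the source are made independent. Say that `x` and
`c` match if `x` is typical and decodable and some typical key encrypts `x` to `c`. For a given `c`,
each key matches at most one `x`, so that for independent `c` and `x` the probability of a match is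
at most the number of typical keys divided by about `2 ^ (n * H(X₁ X₂))`; this gives
`H(X₁ X₂) ≤ H(K₁ K₂)`. For one encoder, given `x₁` there are at most as many matching values of `c₁`
as typical `k₁`, while on the sum-rate line a decodable word rarely has a `c₁` of probability much
above `2 ^ (-n * R.1)`: too few ciphertext pairs contain such a `c₁` to carry the typical source
words (`sum_heavy_le`). This gives `R.1 ≤ H(K₁)`. The bounds `H(X₁ | X₂) ≤ R.1` and
`H(X₂ | X₁) ≤ R.2` follow from counting decodable words (`one_le_error_add_mul`).

**Direct part.** The ciphertext `cᵢ = φᵢ(xᵢ) + fᵢ(kᵢ)` is a bin index of the source word masked, in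
a cyclic group, by a bin index of the key. For random `φ` and `f` the same average, that of the
weight of the bin of a given word (`sum_binMass`), bounds both the error of maximum likelihood
decoding and the divergence of `f(K)` from the uniform law; the latter bounds the leakage
(`mutualInfo_oneTimePad_le`). Both vanish if the rates lie in the interiors of the Slepian–Wolf and
the key regions. The excluded coincidences of entropies are those in which `R` may not be a limit of
such rates. Where a coincidence holds with value zero, the encoders concerned need only one bin,
and the corresponding terms of the bounds are exactly zero.
-/

namespace DistEnc

open Filter Topology

/-! ### Products over independent letters and exponential bounds -/

section

variable {A₁ A₂ : Type*}

lemma iid_mul (f g : A₁ × A₂ → ℝ) (n : ℕ) (x : (Fin n → A₁) × (Fin n → A₂)) :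
    iid (fun z => f z * g z) n x = iid f n x * iid g n x :=
  Finset.prod_mul_distrib

lemma iid_const_mul (c : ℝ) (g : A₁ × A₂ → ℝ) (n : ℕ) (x : (Fin n → A₁) × (Fin n → A₂)) :
    iid (fun z => c * g z) n x = c ^ n * iid g n x := by
  simp [iid, Finset.prod_mul_distrib]

lemma iid_div (f g : A₁ × A₂ → ℝ) (n : ℕ) (x : (Fin n → A₁) × (Fin n → A₂)) :
    iid (fun z => f z / g z) n x = iid f n x / iid g n x := by
  simp [iid, Finset.prod_div_distrib]

lemma iid_one_div (g : A₁ × A₂ → ℝ) (n : ℕ) (x : (Fin n → A₁) × (Fin n → A₂)) :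
    iid (fun z => 1 / g z) n x = 1 / iid g n x := by
  simp [iid]

lemma iid_rpow {g : A₁ × A₂ → ℝ} (hg : ∀ z, 0 ≤ g z) (s : ℝ) (n : ℕ)
    (x : (Fin n → A₁) × (Fin n → A₂)) :
    iid (fun z => g z ^ s) n x = iid g n x ^ s :=
  Real.finsetProd_rpow _ _ (fun _ _ => hg _) _

lemma iid_nonneg {g : A₁ × A₂ → ℝ} (hg : ∀ z, 0 ≤ g z) (n : ℕ)
    (x : (Fin n → A₁) × (Fin n → A₂)) : 0 ≤ iid g n x :=
  Finset.prod_nonneg fun _ _ => hg _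

lemma iid_eq_of_eq_on_support {p q r : A₁ × A₂ → ℝ} (h : ∀ z, p z ≠ 0 → q z = r z) {n : ℕ}
    {x : (Fin n → A₁) × (Fin n → A₂)} (hx : iid p n x ≠ 0) : iid q n x = iid r n x :=
  Finset.prod_congr rfl fun t _ => h _ (Finset.prod_ne_zero_iff.1 hx t (Finset.mem_univ t))

lemma iid_pos_of_ne_zero {p q : A₁ × A₂ → ℝ} (h : ∀ z, p z ≠ 0 → 0 < q z) {n : ℕ}
    {x : (Fin n → A₁) × (Fin n → A₂)} (hx : iid p n x ≠ 0) : 0 < iid q n x :=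
  Finset.prod_pos fun t _ => h _ (Finset.prod_ne_zero_iff.1 hx t (Finset.mem_univ t))

variable [Fintype A₁] [Fintype A₂]

lemma sum_iid (F : A₁ × A₂ → ℝ) (n : ℕ) : ∑ x, iid F n x = (∑ z, F z) ^ n := by
  rw [Fintype.sum_pow, ← Equiv.sum_comp
    (Equiv.arrowProdEquivProdArrow (Fin n) (fun _ => A₁) (fun _ => A₂))]
  rfl

lemma iid_mem_stdSimplex {p : A₁ × A₂ → ℝ} (hp : p ∈ stdSimplex ℝ (A₁ × A₂)) (n : ℕ) :
    iid p n ∈ stdSimplex ℝ ((Fin n → A₁) × (Fin n → A₂)) :=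
  ⟨iid_nonneg hp.1 n, by rw [sum_iid, hp.2, one_pow]⟩

omit [Fintype A₁] in
lemma marg₁_iid (p : A₁ × A₂ → ℝ) (n : ℕ) (x : (Fin n → A₁) × (Fin n → A₂)) :
    marg₁ (iid p n) x.1 = iid (fun z => marg₁ p z.1) n x := by
  simp only [marg₁, iid]
  exact (Fintype.prod_sum fun t b => p (x.1 t, b)).symm

omit [Fintype A₂] in
lemma marg₂_iid (p : A₁ × A₂ → ℝ) (n : ℕ) (x : (Fin n → A₁) × (Fin n → A₂)) :
    marg₂ (iid p n) x.2 = iid (fun z => marg₂ p z.2) n x := by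
  simp only [marg₂, iid]
  exact (Fintype.prod_sum fun t a => p (a, x.2 t)).symm

lemma marg₁_nonneg {α β : Type*} [Fintype β] {p : α × β → ℝ} (hp : ∀ z, 0 ≤ p z) (a : α) :
    0 ≤ marg₁ p a :=
  Finset.sum_nonneg fun _ _ => hp _

lemma marg₂_nonneg {α β : Type*} [Fintype α] {p : α × β → ℝ} (hp : ∀ z, 0 ≤ p z) (b : β) :
    0 ≤ marg₂ p b :=
  Finset.sum_nonneg fun _ _ => hp _

lemma le_marg₁ {α β : Type*} [Fintype β] {p : α × β → ℝ} (hp : ∀ z, 0 ≤ p z) (z : α × β) :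
    p z ≤ marg₁ p z.1 :=
  Finset.single_le_sum (f := fun b => p (z.1, b)) (fun _ _ => hp _) (Finset.mem_univ z.2)

lemma le_marg₂ {α β : Type*} [Fintype α] {p : α × β → ℝ} (hp : ∀ z, 0 ≤ p z) (z : α × β) :
    p z ≤ marg₂ p z.2 :=
  Finset.single_le_sum (f := fun a => p (a, z.2)) (fun _ _ => hp _) (Finset.mem_univ z.1)

lemma marg₁_pos {α β : Type*} [Fintype β] {p : α × β → ℝ} (hp : ∀ z, 0 ≤ p z) {z : α × β}
    (hz : p z ≠ 0) : 0 < marg₁ p z.1 :=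
  ((hp z).lt_of_ne' hz).trans_le (le_marg₁ hp z)

lemma marg₂_pos {α β : Type*} [Fintype α] {p : α × β → ℝ} (hp : ∀ z, 0 ≤ p z) {z : α × β}
    (hz : p z ≠ 0) : 0 < marg₂ p z.2 :=
  ((hp z).lt_of_ne' hz).trans_le (le_marg₂ hp z)

lemma sum_marg₁ {α β : Type*} [Fintype α] [Fintype β] (p : α × β → ℝ) : ∑ a, marg₁ p a = ∑ z, p z :=
  (Fintype.sum_prod_type p).symm

lemma sum_marg₂ {α β : Type*} [Fintype α] [Fintype β] (p : α × β → ℝ) : ∑ b, marg₂ p b = ∑ z, p z :=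
  (Fintype.sum_prod_type_right p).symm

lemma entropy_marg₁ {α β : Type*} [Fintype α] [Fintype β] (p : α × β → ℝ) :
    entropy (marg₁ p) = -∑ z, p z * Real.logb 2 (marg₁ p z.1) := by
  simp only [entropy, Fintype.sum_prod_type, ← Finset.sum_mul]; rfl

lemma entropy_marg₂ {α β : Type*} [Fintype α] [Fintype β] (p : α × β → ℝ) :
    entropy (marg₂ p) = -∑ z, p z * Real.logb 2 (marg₂ p z.2) := by
  simp only [entropy, Fintype.sum_prod_type_right, ← Finset.sum_mul]; rfl

/-- The moment `s ↦ ∑ a, p a * g a ^ s` has value `1` and negative derivative at `s = 0`. -/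
lemma exists_sum_mul_rpow_lt_one {α : Type*} [Fintype α] {p g : α → ℝ} (hp : p ∈ stdSimplex ℝ α)
    (hg : ∀ a, p a ≠ 0 → 0 < g a) (h : ∑ a, p a * Real.log (g a) < 0) :
    ∃ s : ℝ, 0 < s ∧ s ≤ 1 ∧ ∑ a, p a * g a ^ s < 1 := by
  have hd : HasDerivAt (fun s : ℝ => ∑ a, p a * Real.exp (Real.log (g a) * s))
      (∑ a, p a * Real.log (g a)) 0 := by
    refine HasDerivAt.fun_sum fun a _ => ?_
    have := (((hasDerivAt_id (0 : ℝ)).const_mul (Real.log (g a))).exp).const_mul (p a)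
    simpa using this
  have h0 : ∑ a, p a * Real.exp (Real.log (g a) * 0) = 1 := by simpa using hp.2
  have hs := (hasDerivAt_iff_tendsto_slope_zero.1 hd).mono_left
    (nhdsWithin_mono (0 : ℝ) (fun x (hx : 0 < x) => hx.ne') : 𝓝[>] (0 : ℝ) ≤ _)
  have hev := hs.eventually_lt_const h
  have hI : ∀ᶠ s in 𝓝[>] (0 : ℝ), s ∈ Set.Ioc (0 : ℝ) 1 := Ioc_mem_nhdsGT one_pos
  obtain ⟨s, hs1, hs0, hs2⟩ := (hev.and hI).exists
  refine ⟨s, hs0, hs2, ?_⟩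
  rw [zero_add, h0, smul_eq_mul] at hs1
  have h3 := neg_of_mul_neg_right hs1 (inv_nonneg.2 hs0.le)
  have h4 : ∑ a, p a * g a ^ s = ∑ a, p a * Real.exp (Real.log (g a) * s) := by
    refine Finset.sum_congr rfl fun a _ => ?_
    by_cases ha : p a = 0
    · simp [ha]
    · rw [Real.rpow_def_of_pos (hg a ha)]
  linarith

lemma exists_expect_iid_rpow_le {p g : A₁ × A₂ → ℝ} (hp : p ∈ stdSimplex ℝ (A₁ × A₂))
    (hg0 : ∀ z, 0 ≤ g z) (hg : ∀ z, p z ≠ 0 → 0 < g z) (h : ∑ z, p z * Real.log (g z) < 0) :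
    ∃ s : ℝ, 0 < s ∧ s ≤ 1 ∧
      Tendsto (fun n => ∑ x, iid p n x * iid g n x ^ s) atTop (𝓝 0) := by
  obtain ⟨s, h0, h1, h2⟩ := exists_sum_mul_rpow_lt_one hp hg h
  refine ⟨s, h0, h1, ?_⟩
  have : (fun n => ∑ x, iid p n x * iid g n x ^ s) = fun n => (∑ z, p z * g z ^ s) ^ n := by
    ext n
    rw [← sum_iid]
    refine Finset.sum_congr rfl fun x _ => ?_
    rw [iid_mul, iid_rpow hg0]
  rw [this]
  exact tendsto_pow_atTop_nhds_zero_of_lt_one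
    (Finset.sum_nonneg fun z _ => mul_nonneg (hp.1 z) (Real.rpow_nonneg (hg0 z) _)) h2

lemma min_one_le_rpow {y s : ℝ} (hy : 0 ≤ y) (h0 : 0 < s) (h1 : s ≤ 1) : min 1 y ≤ y ^ s := by
  rcases le_total 1 y with h | h
  · rw [min_eq_left h]; exact Real.one_le_rpow h h0.le
  · rw [min_eq_right h]
    exact Real.self_le_rpow_of_le_one hy h h1

lemma log_one_add_le_rpow_div {y s : ℝ} (hy : 0 ≤ y) (h0 : 0 < s) (h1 : s ≤ 1) :
    Real.log (1 + y) ≤ y ^ s / s := by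
  rw [le_div_iff₀ h0, mul_comm, ← Real.log_rpow (by positivity)]
  have h2 : (1 + y) ^ s ≤ 1 + y ^ s := by
    simpa using Real.rpow_add_le_add_rpow zero_le_one hy h0.le h1
  have h3 := Real.log_le_sub_one_of_pos (x := (1 + y) ^ s) (by positivity)
  linarith

lemma sum_mul_log_two_rpow_mul {α : Type*} [Fintype α] {p q : α → ℝ} (hp : p ∈ stdSimplex ℝ α)
    (hq : ∀ a, p a ≠ 0 → 0 < q a) (r : ℝ) :
    ∑ a, p a * Real.log ((2 : ℝ) ^ r * q a) = (r + ∑ a, p a * Real.logb 2 (q a)) * Real.log 2 := by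
  have hl : Real.log 2 ≠ 0 := (Real.log_pos one_lt_two).ne'
  have : ∀ a, p a * Real.log ((2 : ℝ) ^ r * q a)
      = p a * (r * Real.log 2) + p a * Real.logb 2 (q a) * Real.log 2 := by
    intro a
    by_cases ha : p a = 0
    · simp [ha]
    · rw [Real.log_mul (by positivity) (hq a ha).ne', Real.log_rpow two_pos, Real.logb]
      field_simp
  simp_rw [this]
  rw [Finset.sum_add_distrib, ← Finset.sum_mul, ← Finset.sum_mul, hp.2]
  ring

section asymptotics

variable {p q : A₁ × A₂ → ℝ} (hp : p ∈ stdSimplex ℝ (A₁ × A₂)) (hq0 : ∀ z, 0 ≤ q z)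
  (hq : ∀ z, p z ≠ 0 → 0 < q z) {r : ℝ} (h : r + ∑ z, p z * Real.logb 2 (q z) < 0)
include hp hq0 hq h

lemma exists_expect_rate_rpow_tendsto_zero :
    ∃ s : ℝ, 0 < s ∧ s ≤ 1 ∧
      Tendsto (fun n => ∑ x, iid p n x * (((2 : ℝ) ^ r) ^ n * iid q n x) ^ s) atTop (𝓝 0) := by
  have := exists_expect_iid_rpow_le (g := fun z => (2 : ℝ) ^ r * q z) hp
    (fun z => mul_nonneg (by positivity) (hq0 z)) (fun z hz => mul_pos (by positivity) (hq z hz))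
    (by
      rw [sum_mul_log_two_rpow_mul hp hq]
      exact mul_neg_of_neg_of_pos h (Real.log_pos one_lt_two))
  simpa only [iid_const_mul] using this

/-- Law of large numbers in exponential form. With `min 1 _` it bounds probabilities of events and
probabilities of error under random coding. -/
lemma tendsto_expect_min_one :
    Tendsto (fun n => ∑ x, iid p n x * min 1 (((2 : ℝ) ^ r) ^ n * iid q n x)) atTop (𝓝 0) := by
  obtain ⟨s, h0, h1, ht⟩ := exists_expect_rate_rpow_tendsto_zero hp hq0 hq h
  have hy : ∀ n x, 0 ≤ ((2 : ℝ) ^ r) ^ n * iid q n x := fun n x =>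
    mul_nonneg (by positivity) (iid_nonneg hq0 n x)
  exact squeeze_zero
    (fun n => Finset.sum_nonneg fun x _ => mul_nonneg (iid_nonneg hp.1 n x)
      (le_min zero_le_one (hy n x)))
    (fun n => Finset.sum_le_sum fun x _ => mul_le_mul_of_nonneg_left
      (min_one_le_rpow (hy n x) h0 h1) (iid_nonneg hp.1 n x)) ht

/-- The same for a logarithm, which bounds divergences. The logarithm is of order `n` on atypical
words, so their probability has to vanish faster than `1 / n`; a moment bound gives this at once. -/
lemma tendsto_expect_log_one_add :
    Tendsto (fun n => ∑ x, iid p n x * Real.log (1 + ((2 : ℝ) ^ r) ^ n * iid q n x))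
      atTop (𝓝 0) := by
  obtain ⟨s, h0, h1, ht⟩ := exists_expect_rate_rpow_tendsto_zero hp hq0 hq h
  have hy : ∀ n x, 0 ≤ ((2 : ℝ) ^ r) ^ n * iid q n x := fun n x =>
    mul_nonneg (by positivity) (iid_nonneg hq0 n x)
  have ht' := ht.mul_const (1 / s)
  rw [zero_mul] at ht'
  refine squeeze_zero
    (fun n => Finset.sum_nonneg fun x _ => mul_nonneg (iid_nonneg hp.1 n x)
      (Real.log_nonneg (by linarith [hy n x])))
    (fun n => ?_) ht'
  rw [Finset.sum_mul]
  refine Finset.sum_le_sum fun x _ => ?_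
  rw [mul_assoc, mul_one_div]
  exact mul_le_mul_of_nonneg_left (log_one_add_le_rpow_div (hy n x) h0 h1) (iid_nonneg hp.1 n x)

open Classical in
lemma tendsto_prob_one_le :
    Tendsto (fun n => ∑ x, if 1 ≤ ((2 : ℝ) ^ r) ^ n * iid q n x then iid p n x else 0)
      atTop (𝓝 0) := by
  have hy : ∀ n x, 0 ≤ ((2 : ℝ) ^ r) ^ n * iid q n x := fun n x =>
    mul_nonneg (by positivity) (iid_nonneg hq0 n x)
  refine squeeze_zero
    (fun n => Finset.sum_nonneg fun x _ => ?_)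
    (fun n => Finset.sum_le_sum fun x _ => ?_) (tendsto_expect_min_one hp hq0 hq h)
  · split_ifs; exacts [iid_nonneg hp.1 n x, le_rfl]
  · split_ifs with hc
    · rw [min_eq_left hc, mul_one]
    · exact mul_nonneg (iid_nonneg hp.1 n x) (le_min zero_le_one (hy n x))

end asymptotics

end

/-! ### Mutual information and change of measure -/

section

/-- The tangent to the logarithm at `exp c`, as a lower bound for a term of a divergence. -/
lemma sub_add_le_mul_log_div {x q : ℝ} (hx : 0 ≤ x) (hq : 0 ≤ q) (h : x ≠ 0 → q ≠ 0) (c : ℝ) :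
    x - q * Real.exp c + x * c ≤ x * Real.log (x / q) := by
  rcases hx.eq_or_lt with rfl | hx
  · simp; positivity
  · have hq' : 0 < q := hq.lt_of_ne' (h hx.ne')
    have h1 := Real.log_le_sub_one_of_pos (x := q * Real.exp c / x) (by positivity)
    rw [Real.log_div (by positivity) hx.ne', Real.log_mul hq'.ne' (Real.exp_pos c).ne',
      Real.log_exp] at h1
    rw [Real.log_div hx.ne' hq'.ne']
    have h2 := mul_le_mul_of_nonneg_left h1 hx.le
    have h3 : x * (q * Real.exp c / x - 1) = q * Real.exp c - x := by field_simp
    rw [h3] at h2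
    linarith

section

variable {α β : Type*} [Fintype α] [Fintype β]

lemma sum_marg_mul_marg (P : α × β → ℝ) :
    ∑ z : α × β, marg₁ P z.1 * marg₂ P z.2 = (∑ z, P z) * ∑ z, P z := by
  rw [Fintype.sum_prod_type, ← Fintype.sum_mul_sum, sum_marg₁, sum_marg₂]

lemma mutualInfo_mul_log_two (P : α × β → ℝ) :
    mutualInfo P * Real.log 2 = ∑ z, P z * Real.log (P z / (marg₁ P z.1 * marg₂ P z.2)) := by
  have hl : Real.log 2 ≠ 0 := (Real.log_pos one_lt_two).ne'
  rw [mutualInfo, Finset.sum_mul]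
  refine Finset.sum_congr rfl fun z _ => ?_
  rw [Real.logb]; field_simp

lemma marg_mul_marg_ne_zero {P : α × β → ℝ} (hP : ∀ z, 0 ≤ P z) {z : α × β} (hz : P z ≠ 0) :
    marg₁ P z.1 * marg₂ P z.2 ≠ 0 :=
  (mul_pos (marg₁_pos hP hz) (marg₂_pos hP hz)).ne'

lemma mutualInfo_nonneg {P : α × β → ℝ} (hP : P ∈ stdSimplex ℝ (α × β)) : 0 ≤ mutualInfo P := by
  have hl : 0 < Real.log 2 := Real.log_pos one_lt_two
  have h : 0 ≤ mutualInfo P * Real.log 2 := by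
    rw [mutualInfo_mul_log_two]
    calc (0 : ℝ) = ∑ z, (P z - marg₁ P z.1 * marg₂ P z.2 * Real.exp 0 + P z * 0) := by
          simp [Finset.sum_sub_distrib, sum_marg_mul_marg, hP.2]
      _ ≤ _ := Finset.sum_le_sum fun z _ => sub_add_le_mul_log_div (hP.1 z)
          (mul_nonneg (marg₁_nonneg hP.1 _) (marg₂_nonneg hP.1 _)) (marg_mul_marg_ne_zero hP.1) 0
  exact nonneg_of_mul_nonneg_left h hl

open Classical in
/-- An event of probability at least `η` under a joint law of small mutual information cannot be
too unlikely when the two components are made independent. -/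
lemma exp_le_prod_prob_of_mutualInfo_le {P : α × β → ℝ} (hP : P ∈ stdSimplex ℝ (α × β))
    {δ η : ℝ} (hη : 0 < η) (hI : mutualInfo P ≤ δ) (A : α × β → Prop)
    (hA : η ≤ ∑ z, if A z then P z else 0) :
    Real.exp (-((δ * Real.log 2 + 1) / η)) ≤
      ∑ z : α × β, if A z then marg₁ P z.1 * marg₂ P z.2 else 0 := by
  have hl : 0 < Real.log 2 := Real.log_pos one_lt_two
  have hδ : 0 ≤ δ := (mutualInfo_nonneg hP).trans hI
  -- On `A` the tangent to the logarithm is taken at `exp L`, elsewhere at `1`; this `L` makes the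
  -- resulting lower bound for the mutual information exceed `δ` when `A` is too unlikely.
  set L : ℝ := (δ * Real.log 2 + 1) / η with hL
  have hL0 : 0 ≤ L := by positivity
  have hLη : L * η = δ * Real.log 2 + 1 := by rw [hL]; field_simp
  set Q : α × β → ℝ := fun z => marg₁ P z.1 * marg₂ P z.2
  have hQ : ∀ z, 0 ≤ Q z := fun z => mul_nonneg (marg₁_nonneg hP.1 _) (marg₂_nonneg hP.1 _)
  have hQ1 : ∑ z, Q z = 1 := by rw [sum_marg_mul_marg, hP.2, one_mul]
  set QA := ∑ z, if A z then Q z else 0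
  set PA := ∑ z, if A z then P z else 0
  have h1 : ∑ z, (P z - Q z + L * (if A z then P z else 0)
      - Real.exp L * (if A z then Q z else 0)) ≤ δ * Real.log 2 := by
    refine le_trans ?_ (mul_le_mul_of_nonneg_right hI hl.le)
    rw [mutualInfo_mul_log_two]
    refine Finset.sum_le_sum fun z _ => ?_
    split_ifs
    · refine le_trans ?_
        (sub_add_le_mul_log_div (hP.1 z) (hQ z) (marg_mul_marg_ne_zero hP.1) L)
      linarith [hQ z]
    · refine le_trans ?_
        (sub_add_le_mul_log_div (hP.1 z) (hQ z) (marg_mul_marg_ne_zero hP.1) 0)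
      simp
  rw [Finset.sum_sub_distrib, Finset.sum_add_distrib, Finset.sum_sub_distrib, ← Finset.mul_sum,
    ← Finset.mul_sum, hP.2, hQ1] at h1
  have h2 : L * η ≤ L * PA := mul_le_mul_of_nonneg_left hA hL0
  have h3 : 1 ≤ Real.exp L * QA := by linarith
  rw [Real.exp_neg]
  rwa [inv_le_iff_one_le_mul₀' (Real.exp_pos L)]

end

/-! ### Encryption of a source with an independent key -/

section Encryption

variable {α κ C : Type*} [Fintype α] [Fintype κ] [Fintype C]

open Classical in
/-- The joint law of the ciphertext `enc k x` and the source `x`, for a source of law `P` and an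
independent key of law `Q`. -/
noncomputable def encLaw (P : α → ℝ) (Q : κ → ℝ) (enc : κ → α → C) (z : C × α) : ℝ :=
  ∑ k, if enc k z.2 = z.1 then P z.2 * Q k else 0

variable {P : α → ℝ} {Q : κ → ℝ} (hP : P ∈ stdSimplex ℝ α) (hQ : Q ∈ stdSimplex ℝ κ)
  (enc : κ → α → C)

omit [Fintype α] [Fintype C] in
lemma encLaw_nonneg (hP : ∀ x, 0 ≤ P x) (hQ : ∀ k, 0 ≤ Q k) (z : C × α) :
    0 ≤ encLaw P Q enc z :=
  Finset.sum_nonneg fun k _ => by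
    split_ifs; exacts [mul_nonneg (hP _) (hQ _), le_rfl]

lemma sum_mul_encLaw (F : C × α → ℝ) :
    ∑ z, F z * encLaw P Q enc z = ∑ x, ∑ k, P x * Q k * F (enc k x, x) := by
  classical
  rw [Fintype.sum_prod_type_right]
  refine Finset.sum_congr rfl fun x _ => ?_
  simp only [encLaw, Finset.mul_sum]
  rw [Finset.sum_comm]
  refine Finset.sum_congr rfl fun k _ => ?_
  simp [mul_comm]

omit [Fintype α] in
include hQ in
lemma marg₂_encLaw (x : α) : marg₂ (encLaw P Q enc) x = P x := by
  classical
  simp only [marg₂, encLaw]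
  rw [Finset.sum_comm]
  simp [← Finset.mul_sum, hQ.2]

include hP hQ in
lemma encLaw_mem_stdSimplex : encLaw P Q enc ∈ stdSimplex ℝ (C × α) := by
  refine ⟨encLaw_nonneg enc hP.1 hQ.1, ?_⟩
  rw [← sum_marg₂]
  simp_rw [marg₂_encLaw hQ enc]
  exact hP.2

omit [Fintype C] in
include hP hQ in
lemma sum_sum_prod_eq_one : ∑ x, ∑ k, P x * Q k = 1 := by
  rw [← Fintype.sum_mul_sum, hP.2, hQ.2, one_mul]

open Classical in
include hP hQ in
/-- If `good k x` has probability at least `η` and the leakage is at most `δ`, then, for an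
independent ciphertext and source, some key `k` that is good for `x` encrypts `x` to `c` with
probability bounded away from zero. -/
lemma exp_le_of_leakage_le {δ η : ℝ} (hη : 0 < η) (hI : mutualInfo (encLaw P Q enc) ≤ δ)
    (good : κ → α → Prop)
    (hgood : ∑ x, ∑ k, (if good k x then 0 else P x * Q k) ≤ 1 - η) :
    Real.exp (-((δ * Real.log 2 + 1) / η)) ≤
      ∑ c, ∑ x, if ∃ k, good k x ∧ enc k x = c then marg₁ (encLaw P Q enc) c * P x else 0 := by
  have hL := encLaw_mem_stdSimplex hP hQ enc
  have := exp_le_prod_prob_of_mutualInfo_le hL hη hI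
    (fun z => ∃ k, good k z.2 ∧ enc k z.2 = z.1) ?_
  · rw [Fintype.sum_prod_type] at this
    simpa only [marg₂_encLaw hQ enc] using this
  · have h1 := sum_mul_encLaw (P := P) (Q := Q) enc
      (fun z => if ∃ k, good k z.2 ∧ enc k z.2 = z.1 then 1 else 0)
    simp only [ite_mul, one_mul, zero_mul] at h1
    refine le_of_le_of_eq ?_ (h1.symm.trans (by congr!))
    have h2 := sum_sum_prod_eq_one hP hQ
    have h3 : ∑ x, ∑ k, P x * Q k - ∑ x, ∑ k, (if good k x then 0 else P x * Q k) ≤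
        ∑ x, ∑ k, P x * Q k * (if ∃ k', good k' x ∧ enc k' x = enc k x then 1 else 0) := by
      simp only [← Finset.sum_sub_distrib]
      refine Finset.sum_le_sum fun x _ => Finset.sum_le_sum fun k _ => ?_
      have h4 := mul_nonneg (hP.1 x) (hQ.1 k)
      by_cases hg : good k x
      · have : ∃ k', good k' x ∧ enc k' x = enc k x := ⟨k, hg, rfl⟩
        simp [hg, this]
      · simp only [hg, if_false, sub_self]
        split_ifs <;> simp [h4]
    linarith

open Classical in
/-- For each ciphertext, every key of a set `T` explains at most one source word of a set `D` on
which the encryption can be inverted; there are thus at most `#T` candidates for the source. -/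
lemma sum_explained_le_card_mul {W : C → ℝ} (hW0 : ∀ c, 0 ≤ W c)
    (hW1 : ∑ c, W c = 1) (D : α → Prop) (T : Finset κ) {B : ℝ} (hB : 0 ≤ B)
    (good : κ → α → Prop) (hgood : ∀ k x, good k x → D x ∧ k ∈ T)
    (hDB : ∀ x, D x → P x ≤ B)
    (hinj : ∀ k x x', D x → D x' → enc k x = enc k x' → x = x') :
    ∑ c, ∑ x, (if ∃ k, good k x ∧ enc k x = c then W c * P x else 0) ≤ T.card * B := by
  have key : ∀ c, ∑ x, (if ∃ k, good k x ∧ enc k x = c then W c * P x else 0)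
      ≤ W c * (T.card * B) := by
    intro c
    rw [← Finset.sum_filter, ← Finset.mul_sum]
    refine mul_le_mul_of_nonneg_left ?_ (hW0 c)
    set F := Finset.univ.filter fun x => ∃ k, good k x ∧ enc k x = c with hF
    have hcard : F.card ≤ T.card * 1 := by
      refine (Finset.card_le_card (t := T.biUnion fun k =>
        Finset.univ.filter fun x => D x ∧ enc k x = c) ?_).trans
        (Finset.card_biUnion_le_card_mul _ _ _ fun k _ => ?_)
      · intro x hx
        obtain ⟨k, hg, hc⟩ := (Finset.mem_filter.1 hx).2
        obtain ⟨hD, hk⟩ := hgood k x hg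
        exact Finset.mem_biUnion.2 ⟨k, hk, by simp [hD, hc]⟩
      · refine Finset.card_le_one.2 fun x hx x' hx' => ?_
        simp only [Finset.mem_filter, Finset.mem_univ, true_and] at hx hx'
        exact hinj k x x' hx.1 hx'.1 (hx.2.trans hx'.2.symm)
    calc ∑ x ∈ F, P x ≤ F.card • B := Finset.sum_le_card_nsmul _ _ _ fun x hx => by
            obtain ⟨k, hg, -⟩ := (Finset.mem_filter.1 hx).2
            exact hDB x (hgood k x hg).1
      _ ≤ T.card * B := by
          rw [nsmul_eq_mul]
          exact mul_le_mul_of_nonneg_right (by exact_mod_cast (mul_one T.card ▸ hcard)) hB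
  calc _ ≤ ∑ c, W c * (T.card * B) := Finset.sum_le_sum fun c _ => key c
    _ = T.card * B := by rw [← Finset.sum_mul, hW1, one_mul]

open Classical in
/-- If one part `π c` of the ciphertext depends on the key only through `ρ k`, then, for each
source word, the values of `ρ k` in `T` explain at most `#T` values of `π c`; the light ones among
them have total probability at most `#T * B`. -/
lemma sum_light_explained_le_card_mul {κ' C' : Type*} [Fintype C'] (hP : P ∈ stdSimplex ℝ α)
    {W : C → ℝ} (hW0 : ∀ c, 0 ≤ W c) (π : C → C') (ρ : κ → κ') (enc' : κ' → α → C')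
    (henc : ∀ k x, π (enc k x) = enc' (ρ k) x) (T : Finset κ') {B : ℝ} (hB : 0 ≤ B)
    (good : κ → α → Prop)
    (hgood : ∀ k x, good k x →
      ρ k ∈ T ∧ ∑ c', (if π c' = π (enc k x) then W c' else 0) ≤ B) :
    ∑ c, ∑ x, (if ∃ k, good k x ∧ enc k x = c then W c * P x else 0) ≤ T.card * B := by
  rw [Finset.sum_comm]
  have key : ∀ x, ∑ c, (if ∃ k, good k x ∧ enc k x = c then W c * P x else 0)
      ≤ (T.card * B) * P x := by
    intro x
    rw [← Finset.sum_filter, ← Finset.sum_mul]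
    refine mul_le_mul_of_nonneg_right ?_ (hP.1 x)
    set F := Finset.univ.filter fun c => ∃ k, good k x ∧ enc k x = c
    set T' := T.filter fun j => ∑ c', (if π c' = enc' j x then W c' else 0) ≤ B
    have hnn : ∀ c, ∀ j ∈ T', 0 ≤ (if π c = enc' j x then W c else 0) := fun c j _ => by
      split_ifs; exacts [hW0 c, le_rfl]
    calc ∑ c ∈ F, W c ≤ ∑ c ∈ F, ∑ j ∈ T', (if π c = enc' j x then W c else 0) := by
          refine Finset.sum_le_sum fun c hc => ?_
          obtain ⟨k, hg, rfl⟩ := (Finset.mem_filter.1 hc).2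
          obtain ⟨hk, hl⟩ := hgood k x hg
          rw [henc] at hl ⊢
          have := Finset.single_le_sum (hnn (enc k x)) (Finset.mem_filter.2 ⟨hk, hl⟩)
          rwa [henc, if_pos rfl] at this
      _ ≤ ∑ c, ∑ j ∈ T', (if π c = enc' j x then W c else 0) :=
          Finset.sum_le_sum_of_subset_of_nonneg (Finset.subset_univ _) fun c _ _ =>
            Finset.sum_nonneg (hnn c)
      _ = ∑ j ∈ T', ∑ c, (if π c = enc' j x then W c else 0) := Finset.sum_comm
      _ ≤ T'.card • B := Finset.sum_le_card_nsmul _ _ _ fun j hj =>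
          (Finset.mem_filter.1 hj).2
      _ ≤ T.card * B := by
          rw [nsmul_eq_mul]
          exact mul_le_mul_of_nonneg_right
            (by exact_mod_cast Finset.card_le_card (Finset.filter_subset _ _)) hB
  calc _ ≤ ∑ x, (T.card * B) * P x := Finset.sum_le_sum fun x _ => key x
    _ = T.card * B := by rw [← Finset.mul_sum, hP.2, mul_one]

open Classical in
/-- Few ciphertexts have a heavy part `π c`, and every key maps decodable source words to different
ciphertexts; a heavy `π c` is thus unlikely. -/
lemma sum_heavy_le {C' : Type*} [Fintype C'] (hQ : Q ∈ stdSimplex ℝ κ)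
    {W : C → ℝ} (hW0 : ∀ c, 0 ≤ W c) (hW1 : ∑ c, W c = 1) (π : C → C') {N : ℝ}
    (hN : ∀ c', ((Finset.univ.filter fun c => π c = c').card : ℝ) ≤ N) (hN0 : 0 ≤ N)
    (D : α → Prop) {B B' : ℝ} (hB : 0 < B) (hB' : 0 ≤ B') (hDB : ∀ x, D x → P x ≤ B')
    (heavy : κ → α → Prop) (hheavy : ∀ k x, heavy k x →
      D x ∧ B < ∑ c', (if π c' = π (enc k x) then W c' else 0))
    (hinj : ∀ k x x', D x → D x' → enc k x = enc k x' → x = x') :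
    ∑ x, ∑ k, (if heavy k x then P x * Q k else 0) ≤ N / B * B' := by
  rw [Finset.sum_comm]
  set w : C' → ℝ := fun c' => ∑ c, (if π c = c' then W c else 0) with hw
  set H := Finset.univ.filter fun c' => B < w c' with hH
  have hHcard : (H.card : ℝ) ≤ 1 / B := by
    rw [le_div_iff₀ hB, ← nsmul_eq_mul]
    calc H.card • B ≤ ∑ c' ∈ H, w c' :=
          Finset.card_nsmul_le_sum _ _ _ fun c' hc' => (Finset.mem_filter.1 hc').2.le
      _ ≤ ∑ c', w c' := Finset.sum_le_sum_of_subset_of_nonneg (Finset.subset_univ _) fun c' _ _ =>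
          Finset.sum_nonneg fun c _ => by split_ifs; exacts [hW0 c, le_rfl]
      _ = 1 := by rw [hw, Finset.sum_comm]; simpa using hW1
  have key : ∀ k, ∑ x, (if heavy k x then P x * Q k else 0)
      ≤ (N / B * B') * Q k := by
    intro k
    rw [← Finset.sum_filter, ← Finset.sum_mul]
    refine mul_le_mul_of_nonneg_right ?_ (hQ.1 k)
    set F := Finset.univ.filter fun x => heavy k x with hF
    have hcard : (F.card : ℝ) ≤ N / B := by
      have h1 : F.card ≤ (H.biUnion fun c' => Finset.univ.filter fun c => π c = c').card := by
        refine Finset.card_le_card_of_injOn (enc k) ?_ ?_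
        · intro x hx
          have hx' := hheavy k x (Finset.mem_filter.1 hx).2
          exact Finset.mem_coe.2 (Finset.mem_biUnion.2
            ⟨π (enc k x), Finset.mem_filter.2 ⟨Finset.mem_univ _, hx'.2⟩, by simp⟩)
        · intro x hx x' hx' he
          exact hinj k x x' (hheavy k x (Finset.mem_filter.1 hx).2).1
            (hheavy k x' (Finset.mem_filter.1 hx').2).1 he
      calc (F.card : ℝ) ≤ ((∑ c' ∈ H, (Finset.univ.filter fun c => π c = c').card : ℕ) : ℝ) := by
            exact_mod_cast h1.trans Finset.card_biUnion_le
        _ ≤ H.card • N := by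
            push_cast
            exact Finset.sum_le_card_nsmul _ _ _ fun c' _ => hN c'
        _ ≤ N / B := by
            rw [nsmul_eq_mul, div_eq_mul_one_div, mul_comm N]
            exact mul_le_mul_of_nonneg_right hHcard hN0
    calc ∑ x ∈ F, P x ≤ F.card • B' := Finset.sum_le_card_nsmul _ _ _ fun x hx =>
          hDB x (hheavy k x (Finset.mem_filter.1 hx).2).1
      _ ≤ N / B * B' := by
          rw [nsmul_eq_mul]; exact mul_le_mul_of_nonneg_right hcard hB'
  calc _ ≤ ∑ k, (N / B * B') * Q k := Finset.sum_le_sum fun k _ => key k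
    _ = N / B * B' := by rw [← Finset.mul_sum, hQ.2, mul_one]

end Encryption

end

section

/-! ### Bounds at a fixed block length -/

section FixedLength

variable {α κ C : Type*} [Fintype α] [Fintype κ]

lemma ite_nonneg {p : Prop} [Decidable p] {a : ℝ} (ha : 0 ≤ a) : 0 ≤ if p then a else 0 := by
  split_ifs; exacts [ha, le_rfl]

lemma ite_le_of_nonneg {p : Prop} [Decidable p] {a : ℝ} (ha : 0 ≤ a) :
    (if p then 0 else a) ≤ a := by
  split_ifs; exacts [ha, le_rfl]

open Classical in
lemma card_filter_lt_le_inv {w : κ → ℝ} (hw : w ∈ stdSimplex ℝ κ) {b : ℝ} (hb : 0 < b) :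
    ((Finset.univ.filter fun k => b < w k).card : ℝ) ≤ b⁻¹ := by
  rw [← one_div, le_div_iff₀ hb, ← nsmul_eq_mul, ← hw.2]
  exact (Finset.card_nsmul_le_sum _ _ _ fun k hk => (Finset.mem_filter.1 hk).2.le).trans
    (Finset.sum_le_sum_of_subset_of_nonneg (Finset.subset_univ _) fun k _ _ => hw.1 k)

open Classical in
/-- If given `π x` at most `N` decodable words are possible, then decodable words whose
conditional probability given `π x` is less than `b` have probability at most `N * b`. -/
lemma one_le_error_add_mul {β : Type*} [Fintype β] {P : α → ℝ} (hP : P ∈ stdSimplex ℝ α)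
    {w : β → ℝ} (hw : w ∈ stdSimplex ℝ β) (π : α → β) (D : α → Prop) {N b : ℝ} (hb : 0 ≤ b)
    (hN : ∀ y, ((Finset.univ.filter fun x => D x ∧ π x = y).card : ℝ) ≤ N) :
    1 ≤ ∑ x, (if D x then 0 else P x) + ∑ x, (if w (π x) * b ≤ P x then P x else 0) + N * b := by
  have h1 : ∑ x, (if D x then w (π x) * b else 0) ≤ N * b := by
    have : ∑ x, (if D x then w (π x) * b else 0)
        = ∑ y, (Finset.univ.filter fun x => D x ∧ π x = y).card * (w y * b) := by
      simp_rw [← nsmul_eq_mul, ← Finset.sum_const, Finset.sum_filter]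
      rw [Finset.sum_comm]
      refine Finset.sum_congr rfl fun x _ => ?_
      simp [ite_and]
    rw [this]
    calc _ ≤ ∑ y, N * (w y * b) := Finset.sum_le_sum fun y _ =>
          mul_le_mul_of_nonneg_right (hN y) (mul_nonneg (hw.1 y) hb)
      _ = N * b := by rw [← Finset.mul_sum, ← Finset.sum_mul, hw.2, one_mul]
  refine le_trans ?_ (add_le_add_right h1 _)
  rw [← Finset.sum_add_distrib, ← Finset.sum_add_distrib, ← hP.2]
  refine Finset.sum_le_sum fun x _ => ?_
  have h0 := hP.1 x
  have h2 := mul_nonneg (hw.1 (π x)) hb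
  split_ifs <;> linarith

variable [Fintype C] {P : α → ℝ} {Q : κ → ℝ} (hP : P ∈ stdSimplex ℝ α) (hQ : Q ∈ stdSimplex ℝ κ)
  (enc : κ → α → C) {D : α → Prop}
  (hinj : ∀ k x x', D x → D x' → enc k x = enc k x' → x = x')
  {δ η : ℝ} (hη : 0 < η) (hI : mutualInfo (encLaw P Q enc) ≤ δ)
include hP hQ

lemma marg₁_encLaw_simplex : marg₁ (encLaw P Q enc) ∈ stdSimplex ℝ C := by
  have h := encLaw_mem_stdSimplex hP hQ enc
  exact ⟨marg₁_nonneg h.1, by rw [sum_marg₁, h.2]⟩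

include hinj hη hI

open Classical in
/-- Low leakage and decodability force the typical keys to be at least as many as the typical
source words. -/
lemma exp_le_div_of_decodable {b B : ℝ} (hb : 0 < b) (hB : 0 ≤ B)
    (hgood : ∑ x, (if D x then 0 else P x) + ∑ x, (if B ≤ P x then P x else 0)
      + ∑ k, (if Q k ≤ b then Q k else 0) ≤ 1 - η) :
    Real.exp (-((δ * Real.log 2 + 1) / η)) ≤ B / b := by
  have hW := marg₁_encLaw_simplex hP hQ enc
  set T := Finset.univ.filter fun k => b < Q k
  set D' : α → Prop := fun x => D x ∧ P x < B
  obtain ⟨good, hg⟩ : ∃ good : κ → α → Prop, ∀ k x, good k x ↔ D' x ∧ k ∈ T :=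
    ⟨_, fun _ _ => Iff.rfl⟩
  refine (exp_le_of_leakage_le hP hQ enc hη hI good ?_).trans
    ((sum_explained_le_card_mul (P := P) enc hW.1 hW.2 D' T hB good (fun k x => (hg k x).1)
      (fun x hx => hx.2.le)
      fun k x x' h h' => hinj k x x' h.1 h'.1).trans ?_)
  · refine le_trans ?_ hgood
    have h1 : ∀ f : α → ℝ, ∑ x, f x = ∑ x, ∑ k, f x * Q k := fun f => by
      simp [← Finset.mul_sum, hQ.2]
    have h2 : ∀ f : κ → ℝ, ∑ k, f k = ∑ x, ∑ k, P x * f k := fun f => by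
      rw [← Fintype.sum_mul_sum, hP.2, one_mul]
    rw [h1 (fun x => if D x then 0 else P x), h1 (fun x => if B ≤ P x then P x else 0),
      h2 (fun k => if Q k ≤ b then Q k else 0)]
    simp only [← Finset.sum_add_distrib]
    refine Finset.sum_le_sum fun x _ => Finset.sum_le_sum fun k _ => ?_
    have h0 := mul_nonneg (hP.1 x) (hQ.1 k)
    have t1 := mul_nonneg (ite_nonneg (p := ¬ D x) (hP.1 x)) (hQ.1 k)
    have t2 := mul_nonneg (ite_nonneg (p := B ≤ P x) (hP.1 x)) (hQ.1 k)
    have t3 := mul_nonneg (hP.1 x) (ite_nonneg (p := Q k ≤ b) (hQ.1 k))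
    rw [ite_not] at t1
    by_cases hx : D x
    · by_cases hx' : B ≤ P x
      · rw [if_pos hx'] at t2 ⊢
        exact (ite_le_of_nonneg h0).trans (by linarith)
      · by_cases hk : Q k ≤ b
        · rw [if_pos hk] at t3 ⊢
          exact (ite_le_of_nonneg h0).trans (by linarith)
        · rw [if_pos ((hg k x).2 ⟨⟨hx, not_le.1 hx'⟩,
            Finset.mem_filter.2 ⟨Finset.mem_univ k, not_le.1 hk⟩⟩)]
          linarith
    · rw [if_neg hx] at t1 ⊢
      exact (ite_le_of_nonneg h0).trans (by linarith)
  · rw [div_eq_inv_mul]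
    exact mul_le_mul_of_nonneg_right (card_filter_lt_le_inv hQ hb) hB

open Classical in
/-- Low leakage forces the typical values of the part `ρ k` of the key to be at least as many as
the typical values of the part `π c` of the ciphertext. -/
lemma exp_le_div_of_part {κ' C' : Type*} [Fintype κ'] [Fintype C'] (π : C → C') (ρ : κ → κ')
    (enc' : κ' → α → C') (henc : ∀ k x, π (enc k x) = enc' (ρ k) x)
    {N : ℝ} (hN : ∀ c', ((Finset.univ.filter fun c => π c = c').card : ℝ) ≤ N) (hN0 : 0 ≤ N)
    {w : κ' → ℝ} (hw : w ∈ stdSimplex ℝ κ')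
    {b B B' : ℝ} (hb : 0 < b) (hB : 0 < B) (hB' : 0 ≤ B')
    (hgood : ∑ x, (if D x then 0 else P x) + ∑ x, (if B' ≤ P x then P x else 0)
      + ∑ k, (if w (ρ k) ≤ b then Q k else 0) + N / B * B' ≤ 1 - η) :
    Real.exp (-((δ * Real.log 2 + 1) / η)) ≤ B / b := by
  have hW := marg₁_encLaw_simplex hP hQ enc
  set W := marg₁ (encLaw P Q enc)
  set T := Finset.univ.filter fun j => b < w j
  set D' : α → Prop := fun x => D x ∧ P x < B'
  obtain ⟨good, hg⟩ : ∃ good : κ → α → Prop, ∀ k x, good k x ↔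
      ρ k ∈ T ∧ ∑ c', (if π c' = π (enc k x) then W c' else 0) ≤ B := ⟨_, fun _ _ => Iff.rfl⟩
  obtain ⟨heavy, hh⟩ : ∃ heavy : κ → α → Prop, ∀ k x, heavy k x ↔
      D' x ∧ B < ∑ c', (if π c' = π (enc k x) then W c' else 0) := ⟨_, fun _ _ => Iff.rfl⟩
  refine (exp_le_of_leakage_le hP hQ enc hη hI good ?_).trans
    ((sum_light_explained_le_card_mul enc hP hW.1 π ρ enc' henc T hB.le good
      fun k x => (hg k x).1).trans ?_)
  · refine le_trans ?_ hgood
    have h1 : ∀ f : α → ℝ, ∑ x, f x = ∑ x, ∑ k, f x * Q k := fun f => by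
      simp [← Finset.mul_sum, hQ.2]
    have h2 : ∀ f : κ → ℝ, ∑ k, f k = ∑ x, ∑ k, P x * f k := fun f => by
      rw [← Fintype.sum_mul_sum, hP.2, one_mul]
    refine le_trans ?_ (add_le_add_right (sum_heavy_le enc hQ hW.1 hW.2 π hN hN0 D' hB hB'
      (fun x hx => hx.2.le) heavy (fun k x => (hh k x).1)
      fun k x x' h h' => hinj k x x' h.1 h'.1) _)
    rw [h1 (fun x => if D x then 0 else P x), h1 (fun x => if B' ≤ P x then P x else 0),
      h2 (fun k => if w (ρ k) ≤ b then Q k else 0)]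
    simp only [← Finset.sum_add_distrib]
    refine Finset.sum_le_sum fun x _ => Finset.sum_le_sum fun k _ => ?_
    have h0 := mul_nonneg (hP.1 x) (hQ.1 k)
    have t1 := mul_nonneg (ite_nonneg (p := ¬ D x) (hP.1 x)) (hQ.1 k)
    have t2 := mul_nonneg (ite_nonneg (p := B' ≤ P x) (hP.1 x)) (hQ.1 k)
    have t3 := mul_nonneg (hP.1 x) (ite_nonneg (p := w (ρ k) ≤ b) (hQ.1 k))
    have t4 := ite_nonneg (p := heavy k x) h0
    rw [ite_not] at t1
    by_cases hx : D x
    · by_cases hx' : B' ≤ P x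
      · rw [if_pos hx'] at t2 ⊢
        exact (ite_le_of_nonneg h0).trans (by linarith)
      · by_cases hk : w (ρ k) ≤ b
        · rw [if_pos hk] at t3 ⊢
          exact (ite_le_of_nonneg h0).trans (by linarith)
        · by_cases hy : ∑ c', (if π c' = π (enc k x) then W c' else 0) ≤ B
          · rw [if_pos ((hg k x).2 ⟨Finset.mem_filter.2 ⟨Finset.mem_univ _, not_le.1 hk⟩, hy⟩)]
            linarith
          · rw [if_pos ((hh k x).2 ⟨⟨hx, not_le.1 hx'⟩, not_le.1 hy⟩)] at t4 ⊢
            exact (ite_le_of_nonneg h0).trans (by linarith)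
    · rw [if_neg hx] at t1 ⊢
      exact (ite_le_of_nonneg h0).trans (by linarith)
  · rw [div_eq_inv_mul]
    exact mul_le_mul_of_nonneg_right (card_filter_lt_le_inv hw hb) hB.le

end FixedLength

end

/-! ### Typicality at exponential rates -/

section

variable {A₁ A₂ : Type*}

lemma two_rpow_pow_mul (a b : ℝ) (n : ℕ) :
    ((2 : ℝ) ^ a) ^ n * ((2 : ℝ) ^ b) ^ n = ((2 : ℝ) ^ (a + b)) ^ n := by
  rw [← mul_pow, ← Real.rpow_add two_pos]

lemma two_rpow_pow_div (a b : ℝ) (n : ℕ) :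
    ((2 : ℝ) ^ a) ^ n / ((2 : ℝ) ^ b) ^ n = ((2 : ℝ) ^ (a - b)) ^ n := by
  rw [← div_pow, ← Real.rpow_sub two_pos]

lemma tendsto_two_rpow_pow {a : ℝ} (ha : a < 0) :
    Tendsto (fun n : ℕ => ((2 : ℝ) ^ a) ^ n) atTop (𝓝 0) :=
  tendsto_pow_atTop_nhds_zero_of_lt_one (by positivity)
    (Real.rpow_lt_one_of_one_lt_of_neg one_lt_two ha)

lemma card_le_two_rpow_pow {n C : ℕ} (hn : 1 ≤ n) {r : ℝ}
    (h : 1 / (n : ℝ) * Real.logb 2 C ≤ r) : (C : ℝ) ≤ ((2 : ℝ) ^ r) ^ n := by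
  rcases Nat.eq_zero_or_pos C with rfl | hC
  · simp; positivity
  · have hn' : (0 : ℝ) < n := by exact_mod_cast hn
    have hC' : (0 : ℝ) < C := by exact_mod_cast hC
    rw [one_div, inv_mul_le_iff₀ hn', Real.logb_le_iff_le_rpow one_lt_two hC'] at h
    rwa [← Real.rpow_mul_natCast two_pos.le, mul_comm r]

section

variable [Fintype A₁] [Fintype A₂] {p q : A₁ × A₂ → ℝ} (hp : p ∈ stdSimplex ℝ (A₁ × A₂))
  (hq0 : ∀ z, 0 ≤ q z) (hq : ∀ z, p z ≠ 0 → 0 < q z)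
include hp hq0 hq

open Classical in
lemma tendsto_prob_rpow_le_iid {r : ℝ} (h : ∑ z, p z * Real.logb 2 (q z) < r) :
    Tendsto (fun n => ∑ x, if ((2 : ℝ) ^ r) ^ n ≤ iid q n x then iid p n x else 0)
      atTop (𝓝 0) := by
  refine (tendsto_prob_one_le hp hq0 hq (r := -r) (by linarith)).congr fun n => ?_
  refine Finset.sum_congr rfl fun x _ => if_congr ?_ rfl rfl
  rw [Real.rpow_neg two_pos.le, inv_pow, ← div_eq_inv_mul, one_le_div (by positivity)]

open Classical in
lemma tendsto_prob_iid_le_rpow {r : ℝ} (h : r < ∑ z, p z * Real.logb 2 (q z)) :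
    Tendsto (fun n => ∑ x, if iid q n x ≤ ((2 : ℝ) ^ r) ^ n then iid p n x else 0)
      atTop (𝓝 0) := by
  have ht := tendsto_prob_one_le (q := fun z => 1 / q z) hp
    (fun z => one_div_nonneg.2 (hq0 z)) (fun z hz => one_div_pos.2 (hq z hz)) (r := r) (by
      simp only [one_div, Real.logb_inv, mul_neg, Finset.sum_neg_distrib]
      linarith)
  refine ht.congr fun n => Finset.sum_congr rfl fun x _ => ?_
  by_cases hx : iid p n x = 0
  · simp [hx]
  · refine if_congr ?_ rfl rfl
    rw [iid_one_div, mul_one_div, one_le_div (iid_pos_of_ne_zero hq hx)]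

end

/-! ### Converse -/

/-- Two correctly decoded pairs of words that have the same ciphertexts under the same keys are
equal. -/
lemma Cryptosystem.injOn_correct {n : ℕ} {E : Cryptosystem A₁ A₂ n} {S : SourceCode A₁ A₂ n}
    (h : E.ActsAs S) {k x x' : (Fin n → A₁) × (Fin n → A₂)} (hx : x ∈ S.correct)
    (hx' : x' ∈ S.correct) (h₁ : E.Φ₁ k.1 x.1 = E.Φ₁ k.1 x'.1)
    (h₂ : E.Φ₂ k.2 x.2 = E.Φ₂ k.2 x'.2) : x = x' := by
  have e := h k.1 k.2 x.1 x.2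
  have e' := h k.1 k.2 x'.1 x'.2
  rw [h₁, h₂] at e
  exact (hx.symm.trans (e.symm.trans e')).trans hx'

variable [Fintype A₁] [Fintype A₂]

/-- The two parts of a ciphertext, as a function of the pair of keys and the pair of words. -/
def Cryptosystem.encrypt {n : ℕ} (E : Cryptosystem A₁ A₂ n) (k x : (Fin n → A₁) × (Fin n → A₂)) :
    Fin E.C₁ × Fin E.C₂ :=
  (E.Φ₁ k.1 x.1, E.Φ₂ k.2 x.2)

lemma Cryptosystem.cipherSourceLaw_eq {n : ℕ} (E : Cryptosystem A₁ A₂ n) (pX pK : A₁ × A₂ → ℝ) :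
    E.cipherSourceLaw pX pK = encLaw (iid pX n) (iid pK n) E.encrypt := by
  classical
  ext z
  simp only [Cryptosystem.cipherSourceLaw, encLaw, Cryptosystem.encrypt, Prod.ext_iff]

section Converse

variable {pX pK : A₁ × A₂ → ℝ} (hX : pX ∈ stdSimplex ℝ (A₁ × A₂)) (hK : pK ∈ stdSimplex ℝ (A₁ × A₂))
  {ε δ : ℝ} (hε : ε < 1) {R : ℝ × ℝ} (hR : IsReliableSecure ε δ pX pK R)
include hX hε hR

/-- Strong converse of the Slepian–Wolf theorem: given the second source word, there are at most
`(E n).C₁` decodable first ones, since a fixed key encrypts them injectively. -/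
theorem condEntropy₁_le_of_isReliableSecure : condEntropy₁ pX ≤ R.1 := by
  classical
  by_contra! hlt
  obtain ⟨E, S, hES, hE⟩ := hR
  set γ : ℝ := (condEntropy₁ pX - R.1) / 4 with hγ
  have hγ0 : 0 < γ := by rw [hγ]; linarith
  obtain ⟨n₀, hn₀1, hn₀⟩ := hE γ hγ0
  have e1 := tendsto_prob_rpow_le_iid (q := fun z => pX z / marg₂ pX z.2) hX
    (fun z => div_nonneg (hX.1 z) (marg₂_nonneg hX.1 _))
    (fun z hz => div_pos ((hX.1 z).lt_of_ne' hz) (marg₂_pos hX.1 hz))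
    (r := γ - condEntropy₁ pX) (by rw [condEntropy₁]; linarith)
  have e2 := tendsto_two_rpow_pow (a := R.1 + γ + (γ - condEntropy₁ pX)) (by linarith)
  have e := e1.add e2
  rw [add_zero] at e
  obtain ⟨n, h1, h3⟩ := ((e.eventually_lt_const (sub_pos.2 hε)).and
      (eventually_ge_atTop n₀)).exists
  obtain ⟨hC, -, herr, -⟩ := hn₀ n h3
  rw [SourceCode.errorProb] at herr
  rw [← two_rpow_pow_mul] at h1
  have hm := iid_mem_stdSimplex hX n
  have := one_le_error_add_mul (w := marg₂ (iid pX n)) hm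
    ⟨marg₂_nonneg hm.1, by rw [sum_marg₂, hm.2]⟩ Prod.snd (fun x => x ∈ (S n).correct)
    (b := ((2 : ℝ) ^ (γ - condEntropy₁ pX)) ^ n) (by positivity)
    (N := ((2 : ℝ) ^ (R.1 + γ)) ^ n) fun y => ?_
  · have hle : ∑ x, (if marg₂ (iid pX n) x.2 * ((2 : ℝ) ^ (γ - condEntropy₁ pX)) ^ n ≤ iid pX n x
        then iid pX n x else 0) ≤ ∑ x, (if ((2 : ℝ) ^ (γ - condEntropy₁ pX)) ^ n ≤
          iid (fun z => pX z / marg₂ pX z.2) n x then iid pX n x else 0) := by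
      refine Finset.sum_le_sum fun x _ => ?_
      by_cases hx : iid pX n x = 0
      · simp [hx]
      · refine le_of_eq (if_congr ?_ rfl rfl)
        rw [iid_div, ← marg₂_iid, le_div_iff₀ (marg₂_pos hm.1 hx), mul_comm]
    linarith
  · obtain ⟨k⟩ : Nonempty ((Fin n → A₁) × (Fin n → A₂)) := by
      by_contra hne
      rw [not_nonempty_iff] at hne
      simpa using hm.2
    refine le_trans ?_ (card_le_two_rpow_pow (hn₀1.trans h3) hC)
    rw [← Fintype.card_fin (E n).C₁, ← Finset.card_univ]
    refine Nat.cast_le.2 (Finset.card_le_card_of_injOn (fun x => (E n).Φ₁ k.1 x.1) (by simp)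
      fun x hx x' hx' h => ?_)
    simp only [Finset.coe_filter, Finset.mem_univ, true_and, Set.mem_ofPred_eq] at hx hx'
    exact Cryptosystem.injOn_correct (hES n) hx.1 hx'.1 h (by rw [hx.2, hx'.2])

theorem condEntropy₂_le_of_isReliableSecure : condEntropy₂ pX ≤ R.2 := by
  classical
  by_contra! hlt
  obtain ⟨E, S, hES, hE⟩ := hR
  set γ : ℝ := (condEntropy₂ pX - R.2) / 4 with hγ
  have hγ0 : 0 < γ := by rw [hγ]; linarith
  obtain ⟨n₀, hn₀1, hn₀⟩ := hE γ hγ0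
  have e1 := tendsto_prob_rpow_le_iid (q := fun z => pX z / marg₁ pX z.1) hX
    (fun z => div_nonneg (hX.1 z) (marg₁_nonneg hX.1 _))
    (fun z hz => div_pos ((hX.1 z).lt_of_ne' hz) (marg₁_pos hX.1 hz))
    (r := γ - condEntropy₂ pX) (by rw [condEntropy₂]; linarith)
  have e2 := tendsto_two_rpow_pow (a := R.2 + γ + (γ - condEntropy₂ pX)) (by linarith)
  have e := e1.add e2
  rw [add_zero] at e
  obtain ⟨n, h1, h3⟩ := ((e.eventually_lt_const (sub_pos.2 hε)).and
      (eventually_ge_atTop n₀)).exists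
  obtain ⟨-, hC, herr, -⟩ := hn₀ n h3
  rw [SourceCode.errorProb] at herr
  rw [← two_rpow_pow_mul] at h1
  have hm := iid_mem_stdSimplex hX n
  have := one_le_error_add_mul (w := marg₁ (iid pX n)) hm
    ⟨marg₁_nonneg hm.1, by rw [sum_marg₁, hm.2]⟩ Prod.fst (fun x => x ∈ (S n).correct)
    (b := ((2 : ℝ) ^ (γ - condEntropy₂ pX)) ^ n) (by positivity)
    (N := ((2 : ℝ) ^ (R.2 + γ)) ^ n) fun y => ?_
  · have hle : ∑ x, (if marg₁ (iid pX n) x.1 * ((2 : ℝ) ^ (γ - condEntropy₂ pX)) ^ n ≤ iid pX n x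
        then iid pX n x else 0) ≤ ∑ x, (if ((2 : ℝ) ^ (γ - condEntropy₂ pX)) ^ n ≤
          iid (fun z => pX z / marg₁ pX z.1) n x then iid pX n x else 0) := by
      refine Finset.sum_le_sum fun x _ => ?_
      by_cases hx : iid pX n x = 0
      · simp [hx]
      · refine le_of_eq (if_congr ?_ rfl rfl)
        rw [iid_div, ← marg₁_iid, le_div_iff₀ (marg₁_pos hm.1 hx), mul_comm]
    linarith
  · obtain ⟨k⟩ : Nonempty ((Fin n → A₁) × (Fin n → A₂)) := by
      by_contra hne
      rw [not_nonempty_iff] at hne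
      simpa using hm.2
    refine le_trans ?_ (card_le_two_rpow_pow (hn₀1.trans h3) hC)
    rw [← Fintype.card_fin (E n).C₂, ← Finset.card_univ]
    refine Nat.cast_le.2 (Finset.card_le_card_of_injOn (fun x => (E n).Φ₂ k.2 x.2) (by simp)
      fun x hx x' hx' h => ?_)
    simp only [Finset.coe_filter, Finset.mem_univ, true_and, Set.mem_ofPred_eq] at hx hx'
    exact Cryptosystem.injOn_correct (hES n) hx.1 hx'.1 (by rw [hx.2, hx'.2]) h

include hK

/-- Decodable typical source words cannot outnumber the typical keys. -/
theorem entropy_le_entropy_of_isReliableSecure : entropy pX ≤ entropy pK := by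
  classical
  by_contra! hlt
  obtain ⟨E, S, hES, hE⟩ := hR
  obtain ⟨n₀, -, hn₀⟩ := hE 1 one_pos
  set γ : ℝ := (entropy pX - entropy pK) / 4 with hγ
  have hγ0 : 0 < γ := by rw [hγ]; linarith
  have hη : 0 < (1 - ε) / 2 := by linarith
  have e1 := tendsto_prob_rpow_le_iid hX hX.1 (fun z hz => (hX.1 z).lt_of_ne' hz)
    (r := γ - entropy pX) (by rw [entropy]; linarith)
  have e2 := tendsto_prob_iid_le_rpow hK hK.1 (fun z hz => (hK.1 z).lt_of_ne' hz)
    (r := -γ - entropy pK) (by rw [entropy]; linarith)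
  have e := e1.add e2
  rw [add_zero] at e
  have u := tendsto_two_rpow_pow (a := (γ - entropy pX) - (-γ - entropy pK)) (by linarith)
  obtain ⟨n, ⟨h1, h2⟩, h3⟩ := ((e.eventually_lt_const hη).and
    (u.eventually_lt_const (Real.exp_pos (-((δ * Real.log 2 + 1) / ((1 - ε) / 2)))))).and
      (eventually_ge_atTop n₀) |>.exists
  obtain ⟨-, -, herr, hleak⟩ := hn₀ n h3
  rw [Cryptosystem.leakage, Cryptosystem.cipherSourceLaw_eq] at hleak
  rw [SourceCode.errorProb] at herr
  refine h2.not_ge ?_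
  rw [← two_rpow_pow_div]
  exact exp_le_div_of_decodable (D := fun x => x ∈ (S n).correct) (iid_mem_stdSimplex hX n)
    (iid_mem_stdSimplex hK n) (E n).encrypt
    (fun k x x' hx hx' he => Cryptosystem.injOn_correct (hES n) hx hx'
      (congrArg Prod.fst he) (congrArg Prod.snd he)) hη hleak (by positivity) (by positivity)
    (by linarith)

/-- On the sum-rate line the ciphertext pairs are just enough for the typical source words, so the
first ciphertext is spread over about `2 ^ (n * R.1)` values. Being almost independent of the
source, it draws this randomness from the first key. -/
theorem rate_le_entropy_marg₁_of_isReliableSecure (hsum : R.1 + R.2 ≤ entropy pX) :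
    R.1 ≤ entropy (marg₁ pK) := by
  classical
  by_contra! hlt
  obtain ⟨E, S, hES, hE⟩ := hR
  set γ : ℝ := (R.1 - entropy (marg₁ pK)) / 6 with hγ
  have hγ0 : 0 < γ := by rw [hγ]; linarith
  obtain ⟨n₀, hn₀1, hn₀⟩ := hE γ hγ0
  have hη : 0 < (1 - ε) / 2 := by linarith
  have e1 := tendsto_prob_rpow_le_iid hX hX.1 (fun z hz => (hX.1 z).lt_of_ne' hz)
    (r := γ - entropy pX) (by rw [entropy]; linarith)
  have e2 := tendsto_prob_iid_le_rpow (q := fun z => marg₁ pK z.1) hK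
    (fun z => marg₁_nonneg hK.1 _) (fun z hz => marg₁_pos hK.1 hz)
    (r := -γ - entropy (marg₁ pK)) (by rw [entropy_marg₁]; linarith)
  have e3 := tendsto_two_rpow_pow
    (a := R.2 + γ - (4 * γ - R.1) + (γ - entropy pX)) (by linarith)
  have e := (e1.add e2).add e3
  rw [add_zero, add_zero] at e
  have u := tendsto_two_rpow_pow (a := (4 * γ - R.1) - (-γ - entropy (marg₁ pK))) (by linarith)
  obtain ⟨n, ⟨h1, h2⟩, h3⟩ := ((e.eventually_lt_const hη).and
    (u.eventually_lt_const (Real.exp_pos (-((δ * Real.log 2 + 1) / ((1 - ε) / 2)))))).and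
      (eventually_ge_atTop n₀) |>.exists
  obtain ⟨-, hC, herr, hleak⟩ := hn₀ n h3
  rw [Cryptosystem.leakage, Cryptosystem.cipherSourceLaw_eq] at hleak
  rw [SourceCode.errorProb] at herr
  refine h2.not_ge ?_
  rw [← two_rpow_pow_div]
  rw [← two_rpow_pow_mul, ← two_rpow_pow_div (R.2 + γ)] at h1
  simp only [← marg₁_iid] at h1
  have hm := iid_mem_stdSimplex hK n
  refine exp_le_div_of_part (D := fun x => x ∈ (S n).correct) (iid_mem_stdSimplex hX n)
    hm (E n).encrypt
    (fun k x x' hx hx' he => Cryptosystem.injOn_correct (hES n) hx hx'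
      (congrArg Prod.fst he) (congrArg Prod.snd he)) hη hleak Prod.fst Prod.fst
    (fun k x => (E n).Φ₁ k x.1) (fun _ _ => rfl) (N := ((2 : ℝ) ^ (R.2 + γ)) ^ n) (fun c => ?_)
    (by positivity) (w := marg₁ (iid pK n)) ⟨marg₁_nonneg hm.1, by rw [sum_marg₁, hm.2]⟩
    (by positivity) (by positivity) (B' := ((2 : ℝ) ^ (γ - entropy pX)) ^ n) (by positivity)
    (by linarith)
  refine le_trans ?_ (card_le_two_rpow_pow (hn₀1.trans h3) hC)
  rw [show (((E n).C₂ : ℕ) : ℝ) = (Finset.univ : Finset (Fin (E n).C₂)).card by simp]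
  refine Nat.cast_le.2 (Finset.card_le_card_of_injOn (t := Finset.univ) Prod.snd (by simp)
    fun c hc c' hc' h => ?_)
  simp only [Finset.coe_filter, Finset.mem_univ, true_and, Set.mem_ofPred_eq] at hc hc'
  exact Prod.ext (hc.trans hc'.symm) h

theorem rate_le_entropy_marg₂_of_isReliableSecure (hsum : R.1 + R.2 ≤ entropy pX) :
    R.2 ≤ entropy (marg₂ pK) := by
  classical
  by_contra! hlt
  obtain ⟨E, S, hES, hE⟩ := hR
  set γ : ℝ := (R.2 - entropy (marg₂ pK)) / 6 with hγ
  have hγ0 : 0 < γ := by rw [hγ]; linarith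
  obtain ⟨n₀, hn₀1, hn₀⟩ := hE γ hγ0
  have hη : 0 < (1 - ε) / 2 := by linarith
  have e1 := tendsto_prob_rpow_le_iid hX hX.1 (fun z hz => (hX.1 z).lt_of_ne' hz)
    (r := γ - entropy pX) (by rw [entropy]; linarith)
  have e2 := tendsto_prob_iid_le_rpow (q := fun z => marg₂ pK z.2) hK
    (fun z => marg₂_nonneg hK.1 _) (fun z hz => marg₂_pos hK.1 hz)
    (r := -γ - entropy (marg₂ pK)) (by rw [entropy_marg₂]; linarith)
  have e3 := tendsto_two_rpow_pow
    (a := R.1 + γ - (4 * γ - R.2) + (γ - entropy pX)) (by linarith)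
  have e := (e1.add e2).add e3
  rw [add_zero, add_zero] at e
  have u := tendsto_two_rpow_pow (a := (4 * γ - R.2) - (-γ - entropy (marg₂ pK))) (by linarith)
  obtain ⟨n, ⟨h1, h2⟩, h3⟩ := ((e.eventually_lt_const hη).and
    (u.eventually_lt_const (Real.exp_pos (-((δ * Real.log 2 + 1) / ((1 - ε) / 2)))))).and
      (eventually_ge_atTop n₀) |>.exists
  obtain ⟨hC, -, herr, hleak⟩ := hn₀ n h3
  rw [Cryptosystem.leakage, Cryptosystem.cipherSourceLaw_eq] at hleak
  rw [SourceCode.errorProb] at herr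
  refine h2.not_ge ?_
  rw [← two_rpow_pow_div]
  rw [← two_rpow_pow_mul, ← two_rpow_pow_div (R.1 + γ)] at h1
  simp only [← marg₂_iid] at h1
  have hm := iid_mem_stdSimplex hK n
  refine exp_le_div_of_part (D := fun x => x ∈ (S n).correct) (iid_mem_stdSimplex hX n)
    hm (E n).encrypt
    (fun k x x' hx hx' he => Cryptosystem.injOn_correct (hES n) hx hx'
      (congrArg Prod.fst he) (congrArg Prod.snd he)) hη hleak Prod.snd Prod.snd
    (fun k x => (E n).Φ₂ k x.2) (fun _ _ => rfl) (N := ((2 : ℝ) ^ (R.1 + γ)) ^ n) (fun c => ?_)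
    (by positivity) (w := marg₂ (iid pK n)) ⟨marg₂_nonneg hm.1, by rw [sum_marg₂, hm.2]⟩
    (by positivity) (by positivity) (B' := ((2 : ℝ) ^ (γ - entropy pX)) ^ n) (by positivity)
    (by linarith)
  refine le_trans ?_ (card_le_two_rpow_pow (hn₀1.trans h3) hC)
  rw [show (((E n).C₁ : ℕ) : ℝ) = (Finset.univ : Finset (Fin (E n).C₁)).card by simp]
  refine Nat.cast_le.2 (Finset.card_le_card_of_injOn (t := Finset.univ) Prod.fst (by simp)
    fun c hc c' hc' h => ?_)
  simp only [Finset.coe_filter, Finset.mem_univ, true_and, Set.mem_ofPred_eq] at hc hc'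
  exact Prod.ext h (hc.trans hc'.symm)

end Converse

end

section

/-! ### Random binning -/

section Binning

variable {α β G₁ G₂ : Type*}

open Classical in
/-- Total weight of the words in the bin of `x`, where `f` assigns bins to the two components. -/
noncomputable def binMass [Fintype α] [Fintype β] (P : α × β → ℝ) (f : (α → G₁) × (β → G₂))
    (x : α × β) : ℝ :=
  ∑ x', if f.1 x'.1 = f.1 x.1 ∧ f.2 x'.2 = f.2 x.2 then P x' else 0

/-- The average of `binMass` over all pairs of maps into `m₁ + 1` and `m₂ + 1` bins, multiplied by
`(m₁ + 1) * (m₂ + 1)`; see `sum_binMass`. -/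
noncomputable def meanBinMass [Fintype α] [Fintype β] (P : α × β → ℝ) (m₁ m₂ : ℝ) (x : α × β) : ℝ :=
  1 + m₁ * marg₁ P x.1 + m₂ * marg₂ P x.2 + m₁ * m₂ * P x

open Classical in
/-- A uniformly random map to `G` sends two distinct points to the same value with probability
`1 / #G`. Shifting the value at `x'` by `a` permutes the maps, which shows that all values of
`f x - f x'` are equally frequent. -/
lemma card_mul_sum_collision {G : Type*} [Fintype α] [Fintype G] [AddCommGroup G] (x x' : α) :
    (Fintype.card G : ℝ) * ∑ f : α → G, (if f x' = f x then (1 : ℝ) else 0)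
      = Fintype.card (α → G) * (1 + (Fintype.card G - 1) * if x' = x then 1 else 0) := by
  by_cases h : x' = x
  · simp [h, mul_comm]
  · have h1 : ∀ a : G, ∑ f : α → G, (if f x' + a = f x then (1 : ℝ) else 0)
        = ∑ f : α → G, (if f x' = f x then (1 : ℝ) else 0) := fun a =>
      Fintype.sum_equiv (Equiv.addRight (Pi.single x' a)) _ _ fun f => by
        simp [Pi.single_eq_of_ne (Ne.symm h)]
    have h2 : ∑ a : G, ∑ f : α → G, (if f x' + a = f x then (1 : ℝ) else 0)
        = Fintype.card (α → G) := by
      rw [Finset.sum_comm]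
      have : ∀ f : α → G, ∑ a : G, (if f x' + a = f x then (1 : ℝ) else 0) = 1 := fun f => by
        simp_rw [← eq_sub_iff_add_eq']
        simp
      simp [this]
    simp only [h1, Finset.sum_const, Finset.card_univ, nsmul_eq_mul] at h2
    rw [h2]; simp [h]

variable [Fintype α] [Fintype β] [Fintype G₁] [Fintype G₂] [AddCommGroup G₁] [AddCommGroup G₂]

open Classical in
lemma sum_binMass {P : α × β → ℝ} (hP : ∑ x, P x = 1) (x : α × β) :
    (Fintype.card G₁ : ℝ) * Fintype.card G₂ * ∑ f : (α → G₁) × (β → G₂), binMass P f x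
      = Fintype.card ((α → G₁) × (β → G₂)) *
        meanBinMass P (Fintype.card G₁ - 1) (Fintype.card G₂ - 1) x := by
  have h1 : ∀ x' : α × β, (Fintype.card G₁ : ℝ) * Fintype.card G₂ *
      ∑ f : (α → G₁) × (β → G₂),
        (if f.1 x'.1 = f.1 x.1 ∧ f.2 x'.2 = f.2 x.2 then (1 : ℝ) else 0)
      = Fintype.card ((α → G₁) × (β → G₂)) *
        ((1 + (Fintype.card G₁ - 1) * if x'.1 = x.1 then 1 else 0) *
          (1 + (Fintype.card G₂ - 1) * if x'.2 = x.2 then 1 else 0)) := by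
    intro x'
    have := congrArg₂ (· * ·) (card_mul_sum_collision (G := G₁) x.1 x'.1)
      (card_mul_sum_collision (G := G₂) x.2 x'.2)
    rw [mul_mul_mul_comm, Fintype.sum_mul_sum, ← Fintype.sum_prod_type'] at this
    rw [Fintype.card_prod, Nat.cast_mul, ← mul_mul_mul_comm, ← this]
    congr 1
    refine Finset.sum_congr rfl fun f _ => ?_
    by_cases h1 : f.1 x'.1 = f.1 x.1 <;> by_cases h2 : f.2 x'.2 = f.2 x.2 <;> simp [h1, h2]
  have h2 : ∑ x', P x' * ((1 + (Fintype.card G₁ - 1 : ℝ) * if x'.1 = x.1 then 1 else 0) *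
          (1 + (Fintype.card G₂ - 1 : ℝ) * if x'.2 = x.2 then 1 else 0))
      = meanBinMass P (Fintype.card G₁ - 1) (Fintype.card G₂ - 1) x := by
    have e1 : ∑ x', P x' * (if x'.1 = x.1 then 1 else 0) = marg₁ P x.1 := by
      rw [Fintype.sum_prod_type_right]
      simp [marg₁]
    have e2 : ∑ x', P x' * (if x'.2 = x.2 then 1 else 0) = marg₂ P x.2 := by
      rw [Fintype.sum_prod_type]
      simp [marg₂]
    have e3 : ∑ x', P x' * ((if x'.1 = x.1 then 1 else 0) * (if x'.2 = x.2 then 1 else 0))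
        = P x := by
      rw [Fintype.sum_prod_type]
      simp
    calc _ = ∑ x', P x' + (Fintype.card G₁ - 1 : ℝ) * ∑ x', P x' * (if x'.1 = x.1 then 1 else 0)
          + (Fintype.card G₂ - 1 : ℝ) * ∑ x', P x' * (if x'.2 = x.2 then 1 else 0)
          + (Fintype.card G₁ - 1 : ℝ) * (Fintype.card G₂ - 1 : ℝ) *
            ∑ x', P x' * ((if x'.1 = x.1 then 1 else 0) * (if x'.2 = x.2 then 1 else 0)) := by
          simp only [Finset.mul_sum, ← Finset.sum_add_distrib]
          exact Finset.sum_congr rfl fun x' _ => by ring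
      _ = _ := by rw [hP, e1, e2, e3, meanBinMass]
  calc _ = ∑ x', P x' * ((Fintype.card G₁ : ℝ) * Fintype.card G₂ *
        ∑ f : (α → G₁) × (β → G₂),
          (if f.1 x'.1 = f.1 x.1 ∧ f.2 x'.2 = f.2 x.2 then (1 : ℝ) else 0)) := by
        simp only [binMass]
        rw [Finset.sum_comm, Finset.mul_sum]
        refine Finset.sum_congr rfl fun x' _ => ?_
        rw [mul_left_comm, Finset.mul_sum _ _ (P x')]
        simp
    _ = _ := by
        rw [← h2, Finset.mul_sum]
        exact Finset.sum_congr rfl fun x' _ => by rw [h1, mul_left_comm]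

omit [Fintype G₁] [Fintype G₂] [AddCommGroup G₁] [AddCommGroup G₂] in
lemma le_binMass {P : α × β → ℝ} (hP : ∀ x, 0 ≤ P x) (f : (α → G₁) × (β → G₂)) (x : α × β) :
    P x ≤ binMass P f x := by
  classical
  have := Finset.single_le_sum (f := fun x' =>
    if f.1 x'.1 = f.1 x.1 ∧ f.2 x'.2 = f.2 x.2 then P x' else 0)
    (fun x' _ => by split_ifs; exacts [hP x', le_rfl]) (Finset.mem_univ x)
  rw [if_pos ⟨rfl, rfl⟩] at this
  exact this.trans_eq (by simp only [binMass])

lemma exists_le_of_sum_le_card_mul {ι : Type*} [Fintype ι] [Nonempty ι] {v : ι → ℝ} {b : ℝ}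
    (h : ∑ i, v i ≤ Fintype.card ι * b) : ∃ i, v i ≤ b := by
  obtain ⟨i, -, hi⟩ := Finset.exists_le_of_sum_le (s := Finset.univ) (f := v) (g := fun _ => b)
    Finset.univ_nonempty (by simpa using h)
  exact ⟨i, hi⟩

omit [Fintype G₁] [Fintype G₂] [AddCommGroup G₁] [AddCommGroup G₂] in
open Classical in
/-- A decoder that outputs a most likely word of each bin errs only on words that weigh at most
half of their bin, and these weigh at most as much as the rest of their bin. -/
lemma exists_decoder [Nonempty (α × β)] {P : α × β → ℝ} (hP : ∀ x, 0 ≤ P x)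
    (f : (α → G₁) × (β → G₂)) :
    ∃ ψ : G₁ → G₂ → α × β, ∀ x,
      (if ψ (f.1 x.1) (f.2 x.2) = x then 0 else P x) ≤ min (P x) (binMass P f x - P x) := by
  have hex : ∀ g : G₁ × G₂, ∃ x, ∀ y, f.1 y.1 = g.1 ∧ f.2 y.2 = g.2 →
      (f.1 x.1 = g.1 ∧ f.2 x.2 = g.2) ∧ P y ≤ P x := by
    intro g
    set F := Finset.univ.filter fun y : α × β => f.1 y.1 = g.1 ∧ f.2 y.2 = g.2
    by_cases hF : F.Nonempty
    · obtain ⟨x, hx, hmax⟩ := F.exists_max_image P hF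
      exact ⟨x, fun y hy => ⟨(Finset.mem_filter.1 hx).2, hmax y (by simp [F, hy])⟩⟩
    · refine ⟨Classical.arbitrary _, fun y hy => absurd ⟨y, ?_⟩ hF⟩
      simp [F, hy]
  choose ψ hψ using hex
  refine ⟨fun g₁ g₂ => ψ (g₁, g₂), fun x => ?_⟩
  have h0 := le_binMass hP f x
  split_ifs with hx
  · exact le_min (hP x) (sub_nonneg.2 h0)
  · refine le_min le_rfl ?_
    obtain ⟨hb, hle⟩ := hψ (f.1 x.1, f.2 x.2) x ⟨rfl, rfl⟩
    set y := ψ (f.1 x.1, f.2 x.2)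
    have h1 : P x + P y ≤ binMass P f x := by
      rw [← Finset.sum_pair (f := P) (Ne.symm hx), binMass, ← Finset.sum_filter]
      refine Finset.sum_le_sum_of_subset_of_nonneg (fun z hz => ?_) fun z _ _ => hP z
      rcases Finset.mem_insert.1 hz with rfl | hz
      · simp
      · rw [Finset.mem_singleton.1 hz]
        exact Finset.mem_filter.2 ⟨Finset.mem_univ _, hb⟩
    linarith

open Classical in
variable (G₁ G₂) in
/-- Random binning as a source code: some binning is at least as good as the average one. -/
lemma exists_binning_error_le [Nonempty (α × β)] {P : α × β → ℝ} (hP : P ∈ stdSimplex ℝ (α × β)) :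
    ∃ (f : (α → G₁) × (β → G₂)) (ψ : G₁ → G₂ → α × β),
      ∑ x, (if ψ (f.1 x.1) (f.2 x.2) = x then 0 else P x) ≤
        ∑ x, min (P x) (meanBinMass P (Fintype.card G₁ - 1) (Fintype.card G₂ - 1) x /
          (Fintype.card G₁ * Fintype.card G₂) - P x) := by
  choose ψ hψ using exists_decoder (G₁ := G₁) (G₂ := G₂) hP.1
  have hM₁ : (0 : ℝ) < Fintype.card G₁ := by exact_mod_cast Fintype.card_pos
  have hM₂ : (0 : ℝ) < Fintype.card G₂ := by exact_mod_cast Fintype.card_pos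
  obtain ⟨f, hf⟩ := exists_le_of_sum_le_card_mul (ι := (α → G₁) × (β → G₂))
    (v := fun f => ∑ x, (if ψ f (f.1 x.1) (f.2 x.2) = x then 0 else P x)) (b := _) (by
      refine (Finset.sum_le_sum fun f _ => Finset.sum_le_sum fun x _ => hψ f x).trans ?_
      rw [Finset.sum_comm]
      refine (Finset.sum_le_sum (g := fun x => Fintype.card ((α → G₁) × (β → G₂)) *
        min (P x) (meanBinMass P (Fintype.card G₁ - 1) (Fintype.card G₂ - 1) x /
          (Fintype.card G₁ * Fintype.card G₂) - P x)) fun x _ => ?_).trans_eq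
        (Finset.mul_sum _ _ _).symm
      rw [mul_min_of_nonneg _ _ (Nat.cast_nonneg _)]
      refine le_min ?_ ?_
      · refine (Finset.sum_le_sum fun f _ => min_le_left _ _).trans_eq ?_
        simp
      · refine (Finset.sum_le_sum fun f _ => min_le_right _ _).trans_eq ?_
        rw [Finset.sum_sub_distrib, mul_sub, ← mul_div_assoc, ← sum_binMass hP.2,
          mul_div_cancel_left₀ _ (by positivity)]
        simp)
  exact ⟨f, ψ f, hf⟩

variable (G₁ G₂) in
/-- Random binning as a privacy amplifier: the left-hand side is the divergence (in nats) of the law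
of the bin of `x` from the uniform law. The bound on its average comes from moving the average over
the binnings inside the concave logarithm. -/
lemma exists_binning_divergence_le {P : α × β → ℝ} (hP : P ∈ stdSimplex ℝ (α × β)) :
    ∃ f : (α → G₁) × (β → G₂),
      ∑ x, P x * Real.log (Fintype.card (G₁ × G₂) * binMass P f x) ≤
        ∑ x, P x * Real.log (meanBinMass P (Fintype.card G₁ - 1) (Fintype.card G₂ - 1) x) := by
  classical
  have hM₁ : (1 : ℝ) ≤ Fintype.card G₁ := by exact_mod_cast Fintype.card_pos
  have hM₂ : (1 : ℝ) ≤ Fintype.card G₂ := by exact_mod_cast Fintype.card_pos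
  refine exists_le_of_sum_le_card_mul ?_
  rw [Finset.sum_comm, Finset.mul_sum]
  refine Finset.sum_le_sum fun x _ => ?_
  rcases (hP.1 x).eq_or_lt with h0 | h0
  · simp [← h0]
  rw [← Finset.mul_sum, mul_left_comm]
  refine mul_le_mul_of_nonneg_left ?_ h0.le
  set m := meanBinMass P (Fintype.card G₁ - 1 : ℝ) (Fintype.card G₂ - 1) x with hm
  have hmpos : 0 < m := by
    have h1 := marg₁_nonneg hP.1 x.1
    have h2 := marg₂_nonneg hP.1 x.2
    have h3 : 0 ≤ (Fintype.card G₁ - 1 : ℝ) := by linarith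
    have h4 : 0 ≤ (Fintype.card G₂ - 1 : ℝ) := by linarith
    rw [hm, meanBinMass]; positivity
  have key : ∀ f : (α → G₁) × (β → G₂), Real.log (Fintype.card (G₁ × G₂) * binMass P f x)
      ≤ Real.log m + (Fintype.card (G₁ × G₂) * binMass P f x / m - 1) := by
    intro f
    have hb : 0 < binMass P f x := h0.trans_le (le_binMass hP.1 f x)
    have hc : (0 : ℝ) < Fintype.card (G₁ × G₂) := by exact_mod_cast Fintype.card_pos
    have := Real.log_le_sub_one_of_pos (x := Fintype.card (G₁ × G₂) * binMass P f x / m)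
      (by positivity)
    rw [Real.log_div (by positivity) hmpos.ne'] at this
    linarith
  refine (Finset.sum_le_sum fun f _ => key f).trans_eq ?_
  rw [Finset.sum_add_distrib, Finset.sum_sub_distrib, ← Finset.sum_div, ← Finset.mul_sum,
    Fintype.card_prod G₁, Nat.cast_mul, sum_binMass hP.2, mul_div_assoc, div_self hmpos.ne']
  simp

end Binning

/-! ### One-time pads in finite groups -/

section OneTimePad

variable {α κ G : Type*} [Fintype α] [Fintype κ] [Fintype G] [AddCommGroup G]

open Classical in
/-- The leakage of a one-time pad in a finite group is at most the divergence of the law of the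
pad from the uniform law. -/
lemma mutualInfo_oneTimePad_le {P : α → ℝ} {Q : κ → ℝ} (hP : P ∈ stdSimplex ℝ α)
    (hQ : Q ∈ stdSimplex ℝ κ) (φ : α → G) (f : κ → G) :
    mutualInfo (encLaw P Q fun k x => φ x + f k) * Real.log 2 ≤
      ∑ k, Q k * Real.log (Fintype.card G * ∑ k', if f k' = f k then Q k' else 0) := by
  set enc : κ → α → G := fun k x => φ x + f k with henc
  have hL := encLaw_mem_stdSimplex hP hQ enc
  set μ : G → ℝ := fun g => ∑ k, if f k = g then Q k else 0 with hμ
  have hμ0 : ∀ g, 0 ≤ μ g := fun g => Finset.sum_nonneg fun k _ => ite_nonneg (hQ.1 k)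
  have hM : (0 : ℝ) < Fintype.card G := by exact_mod_cast Fintype.card_pos
  have hLeq : ∀ z : G × α, encLaw P Q enc z = P z.2 * μ (z.1 - φ z.2) := by
    intro z
    simp only [encLaw, henc, hμ, Finset.mul_sum, mul_ite, mul_zero, eq_sub_iff_add_eq']
  set L := encLaw P Q enc with hLdef
  rw [mutualInfo_mul_log_two]
  have key : ∀ z : G × α, L z * Real.log (L z / (marg₁ L z.1 * marg₂ L z.2)) ≤
      Real.log (Fintype.card G * μ (z.1 - φ z.2)) * L z +
        (L z / (Fintype.card G * marg₁ L z.1) - L z) := by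
    intro z
    by_cases hz : L z = 0
    · simp [hz]
    have hz' : 0 < P z.2 * μ (z.1 - φ z.2) := by
      rw [← hLeq]; exact (hL.1 z).lt_of_ne' hz
    have hPz : 0 < P z.2 := pos_of_mul_pos_left hz' (hμ0 _)
    have hμz : 0 < μ (z.1 - φ z.2) := pos_of_mul_pos_right hz' hPz.le
    have hW := marg₁_pos hL.1 hz
    have e : L z / (marg₁ L z.1 * marg₂ L z.2)
        = (Fintype.card G * μ (z.1 - φ z.2)) * (1 / (Fintype.card G * marg₁ L z.1)) := by
      rw [hLdef, marg₂_encLaw hQ enc, ← hLdef, hLeq z]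
      field_simp
    rw [e, Real.log_mul (by positivity) (by positivity)]
    have h1 := Real.log_le_sub_one_of_pos (x := 1 / (Fintype.card G * marg₁ L z.1)) (by positivity)
    have h2 := mul_le_mul_of_nonneg_left h1 (hL.1 z)
    rw [mul_sub, mul_one, mul_one_div] at h2
    linarith
  refine (Finset.sum_le_sum fun z _ => key z).trans ?_
  rw [Finset.sum_add_distrib, Finset.sum_sub_distrib, hL.2,
    sum_mul_encLaw enc (fun z : G × α => Real.log (Fintype.card G * μ (z.1 - φ z.2)))]
  have h1 : ∑ z : G × α, L z / (Fintype.card G * marg₁ L z.1) ≤ 1 := by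
    rw [Fintype.sum_prod_type]
    simp_rw [← Finset.sum_div]
    calc _ ≤ ∑ _c : G, 1 / (Fintype.card G : ℝ) := Finset.sum_le_sum fun c _ => by
          change marg₁ L c / _ ≤ _
          rcases (marg₁_nonneg hL.1 c).eq_or_lt with h | h
          · rw [← h]; simp
          · rw [div_mul_cancel_right₀ h.ne', one_div]
      _ = 1 := by
          rw [Finset.sum_const, Finset.card_univ, nsmul_eq_mul, mul_one_div, div_self hM.ne']
  have h2 : ∑ x, ∑ k, P x * Q k * Real.log (Fintype.card G * μ (enc k x - φ x))
      = ∑ k, Q k * Real.log (Fintype.card G * μ (f k)) := by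
    simp_rw [henc, add_sub_cancel_left, mul_assoc, ← Finset.mul_sum, ← Finset.sum_mul]
    rw [hP.2, one_mul]
  rw [h2]
  linarith

end OneTimePad

/-! ### Existence of good systems at a fixed block length -/

variable {A₁ A₂ : Type*} [Fintype A₁] [Fintype A₂]

/-- The ciphertexts are bin indices of the source words, masked by bin indices of the keys. The two
binnings are chosen separately: one to be decodable, the other to be nearly uniform. -/
theorem exists_cryptosystem {pX pK : A₁ × A₂ → ℝ} (hX : pX ∈ stdSimplex ℝ (A₁ × A₂))
    (hK : pK ∈ stdSimplex ℝ (A₁ × A₂)) (n m₁ m₂ : ℕ) :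
    ∃ (E : Cryptosystem A₁ A₂ n) (S : SourceCode A₁ A₂ n), E.ActsAs S ∧
      E.C₁ = m₁ + 1 ∧ E.C₂ = m₂ + 1 ∧
      S.errorProb pX ≤ ∑ x, min (iid pX n x)
        (meanBinMass (iid pX n) m₁ m₂ x / ((m₁ + 1) * (m₂ + 1)) - iid pX n x) ∧
      E.leakage pX pK * Real.log 2 ≤
        ∑ k, iid pK n k * Real.log (meanBinMass (iid pK n) m₁ m₂ k) := by
  classical
  have hXn := iid_mem_stdSimplex hX n
  have hKn := iid_mem_stdSimplex hK n
  have : Nonempty ((Fin n → A₁) × (Fin n → A₂)) := by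
    by_contra hne
    rw [not_nonempty_iff] at hne
    simpa using hXn.2
  obtain ⟨φ, ψ, herr⟩ := exists_binning_error_le (Fin (m₁ + 1)) (Fin (m₂ + 1)) hXn
  obtain ⟨f, hf⟩ := exists_binning_divergence_le (Fin (m₁ + 1)) (Fin (m₂ + 1)) hKn
  refine ⟨⟨m₁ + 1, m₂ + 1, fun k x => φ.1 x + f.1 k, fun k x => φ.2 x + f.2 k,
    fun k₁ k₂ c₁ c₂ => ψ (c₁ - f.1 k₁) (c₂ - f.2 k₂)⟩, ⟨m₁ + 1, m₂ + 1, φ.1, φ.2, ψ⟩,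
    fun k₁ k₂ x₁ x₂ => by simp, rfl, rfl, ?_, ?_⟩
  · rw [SourceCode.errorProb]
    simp only [Fintype.card_fin, Nat.cast_add, Nat.cast_one, add_sub_cancel_right] at herr
    refine le_trans (le_of_eq ?_) herr
    refine Finset.sum_congr rfl fun x _ => ?_
    by_cases h : ψ (φ.1 x.1) (φ.2 x.2) = x
    · rw [if_pos h]; exact if_pos h
    · rw [if_neg h]; exact if_neg h
  · simp only [Fintype.card_fin, Nat.cast_add, Nat.cast_one, add_sub_cancel_right] at hf
    refine le_trans ?_ hf
    rw [Cryptosystem.leakage, Cryptosystem.cipherSourceLaw_eq]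
    refine (mutualInfo_oneTimePad_le hXn hKn (fun x => (φ.1 x.1, φ.2 x.2))
      (fun k => (f.1 k.1, f.2 k.2))).trans_eq ?_
    refine Finset.sum_congr rfl fun k _ => ?_
    simp only [binMass, Prod.mk.injEq]
    congr!

end

section

/-! ### Nonnegativity of entropies and the zero-entropy case -/

section ZeroEntropy

variable {α β : Type*} [Fintype α] [Fintype β] {p : α → ℝ}

lemma le_one_of_mem_stdSimplex (hp : p ∈ stdSimplex ℝ α) (a : α) : p a ≤ 1 :=
  hp.2 ▸ Finset.single_le_sum (fun b _ => hp.1 b) (Finset.mem_univ a)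

omit [Fintype α] in
lemma mul_logb_nonpos (hp : ∀ a, 0 ≤ p a) {q : α → ℝ}
    (hq : ∀ a, p a ≠ 0 → 0 < q a ∧ q a ≤ 1) (a : α) : p a * Real.logb 2 (q a) ≤ 0 := by
  by_cases ha : p a = 0
  · simp [ha]
  · exact mul_nonpos_of_nonneg_of_nonpos (hp a)
      (Real.logb_nonpos one_lt_two (hq a ha).1.le (hq a ha).2)

lemma eq_one_of_sum_mul_logb_eq_zero (hp : ∀ a, 0 ≤ p a) {q : α → ℝ}
    (hq : ∀ a, p a ≠ 0 → 0 < q a ∧ q a ≤ 1) (h : ∑ a, p a * Real.logb 2 (q a) = 0) {a : α}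
    (ha : p a ≠ 0) : q a = 1 := by
  have h1 := (Finset.sum_eq_zero_iff_of_nonpos fun a _ => mul_logb_nonpos hp hq a).1 h a
    (Finset.mem_univ a)
  by_contra hne
  have := Real.logb_neg one_lt_two (hq a ha).1 ((hq a ha).2.lt_of_ne hne)
  exact this.ne ((mul_eq_zero.1 h1).resolve_left ha)

lemma eq_one_of_entropy_eq_zero (hp : p ∈ stdSimplex ℝ α) (h : entropy p = 0) {a : α}
    (ha : p a ≠ 0) : p a = 1 :=
  eq_one_of_sum_mul_logb_eq_zero hp.1
    (fun a ha => ⟨(hp.1 a).lt_of_ne' ha, le_one_of_mem_stdSimplex hp a⟩) (neg_eq_zero.1 h) ha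

variable {p : α × β → ℝ} (hp : ∀ z, 0 ≤ p z)
include hp

omit [Fintype α] in
lemma div_marg₁_mem_Ioc {z : α × β} (hz : p z ≠ 0) :
    0 < p z / marg₁ p z.1 ∧ p z / marg₁ p z.1 ≤ 1 :=
  ⟨div_pos ((hp z).lt_of_ne' hz) (marg₁_pos hp hz), div_le_one_of_le₀ (le_marg₁ hp z)
    (marg₁_nonneg hp _)⟩

omit [Fintype β] in
lemma div_marg₂_mem_Ioc {z : α × β} (hz : p z ≠ 0) :
    0 < p z / marg₂ p z.2 ∧ p z / marg₂ p z.2 ≤ 1 :=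
  ⟨div_pos ((hp z).lt_of_ne' hz) (marg₂_pos hp hz), div_le_one_of_le₀ (le_marg₂ hp z)
    (marg₂_nonneg hp _)⟩

lemma condEntropy₁_nonneg : 0 ≤ condEntropy₁ p :=
  neg_nonneg.2 (Finset.sum_nonpos fun z _ => mul_logb_nonpos hp
    (fun _ hz => div_marg₂_mem_Ioc hp hz) z)

lemma condEntropy₂_nonneg : 0 ≤ condEntropy₂ p :=
  neg_nonneg.2 (Finset.sum_nonpos fun z _ => mul_logb_nonpos hp
    (fun _ hz => div_marg₁_mem_Ioc hp hz) z)

lemma marg₂_eq_of_condEntropy₁_eq_zero (h : condEntropy₁ p = 0) {z : α × β} (hz : p z ≠ 0) :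
    marg₂ p z.2 = p z := by
  have := eq_one_of_sum_mul_logb_eq_zero hp (fun _ hz => div_marg₂_mem_Ioc hp hz)
    (neg_eq_zero.1 h) hz
  exact ((div_eq_one_iff_eq (marg₂_pos hp hz).ne').1 this).symm

lemma marg₁_eq_of_condEntropy₂_eq_zero (h : condEntropy₂ p = 0) {z : α × β} (hz : p z ≠ 0) :
    marg₁ p z.1 = p z := by
  have := eq_one_of_sum_mul_logb_eq_zero hp (fun _ hz => div_marg₁_mem_Ioc hp hz)
    (neg_eq_zero.1 h) hz
  exact ((div_eq_one_iff_eq (marg₁_pos hp hz).ne').1 this).symm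

end ZeroEntropy

lemma entropy_le_add {α β : Type*} [Fintype α] [Fintype β] {p : α × β → ℝ}
    (hp : p ∈ stdSimplex ℝ (α × β)) : entropy p ≤ entropy (marg₁ p) + entropy (marg₂ p) := by
  have h := mutualInfo_nonneg hp
  have e : mutualInfo p = entropy (marg₁ p) + entropy (marg₂ p) - entropy p := by
    rw [entropy_marg₁, entropy_marg₂, entropy, mutualInfo, ← Finset.sum_neg_distrib,
      ← Finset.sum_neg_distrib, ← Finset.sum_neg_distrib, ← Finset.sum_add_distrib,
      ← Finset.sum_sub_distrib]
    refine Finset.sum_congr rfl fun z _ => ?_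
    by_cases hz : p z = 0
    · simp [hz]
    · have h1 := (marg₁_pos hp.1 hz).ne'
      have h2 := (marg₂_pos hp.1 hz).ne'
      rw [Real.logb_div hz (mul_ne_zero h1 h2), Real.logb_mul h1 h2]
      ring
  linarith

/-! ### Vanishing error and leakage -/

variable {A₁ A₂ : Type*} [Fintype A₁] [Fintype A₂]

section Limits

variable {p : A₁ × A₂ → ℝ} (hp : p ∈ stdSimplex ℝ (A₁ × A₂))
include hp

lemma tendsto_sum_min_zero_of_rate {q : A₁ × A₂ → ℝ} (hq0 : ∀ z, 0 ≤ q z)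
    (hq : ∀ z, p z ≠ 0 → 0 < q z) {r : ℝ} (h : ∑ z, p z * Real.logb 2 (q z / p z) < r)
    {N : ℕ → ℝ} (hN : ∀ n, ((2 : ℝ) ^ r) ^ n ≤ N n)
    {d : ∀ n, (Fin n → A₁) × (Fin n → A₂) → ℝ} (hd0 : ∀ n x, 0 ≤ d n x)
    (hd : ∀ n x, d n x ≤ iid q n x) :
    Tendsto (fun n => ∑ x, min (iid p n x) (d n x / N n)) atTop (𝓝 0) := by
  have hN0 : ∀ n, 0 < N n := fun n => lt_of_lt_of_le (by positivity) (hN n)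
  refine squeeze_zero (fun n => Finset.sum_nonneg fun x _ =>
    le_min (iid_nonneg hp.1 n x) (div_nonneg (hd0 n x) (hN0 n).le)) (fun n => ?_)
    (tendsto_expect_min_one (q := fun z => q z / p z) hp (fun z => div_nonneg (hq0 z) (hp.1 z))
      (fun z hz => div_pos (hq z hz) ((hp.1 z).lt_of_ne' hz)) (r := -r) (by linarith))
  refine Finset.sum_le_sum fun x _ => ?_
  rcases (iid_nonneg hp.1 n x).eq_or_lt with hx | hx
  · rw [← hx, zero_mul]; exact min_le_left _ _
  · rw [mul_min_of_nonneg _ _ hx.le, mul_one, iid_div, mul_left_comm, mul_div_cancel₀ _ hx.ne']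
    refine min_le_min_left _ ?_
    rw [Real.rpow_neg two_pos.le, inv_pow, ← div_eq_inv_mul]
    exact div_le_div₀ (iid_nonneg hq0 n x) (hd n x) (by positivity) (hN n)

lemma sum_min_eq_zero {n : ℕ} {d : (Fin n → A₁) × (Fin n → A₂) → ℝ} (hd0 : ∀ x, 0 ≤ d x)
    (hd : ∀ x, iid p n x ≠ 0 → d x = 0) (N : ℝ) (hN : 0 ≤ N) :
    ∑ x, min (iid p n x) (d x / N) = 0 := by
  refine Finset.sum_eq_zero fun x _ => ?_
  by_cases hx : iid p n x = 0
  · rw [hx]; exact min_eq_left (div_nonneg (hd0 x) hN)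
  · rw [hd x hx, zero_div]; exact min_eq_right (iid_nonneg hp.1 n x)

lemma tendsto_sum_mul_log_of_rate {q : A₁ × A₂ → ℝ} (hq0 : ∀ z, 0 ≤ q z)
    (hq : ∀ z, p z ≠ 0 → 0 < q z) {r : ℝ} (h : r < -∑ z, p z * Real.logb 2 (q z))
    {m : ℕ → ℝ} (hm0 : ∀ n, 0 ≤ m n) (hm : ∀ n, m n ≤ ((2 : ℝ) ^ r) ^ n) :
    Tendsto (fun n => ∑ x, iid p n x * Real.log (1 + m n * iid q n x)) atTop (𝓝 0) := by
  refine squeeze_zero (fun n => Finset.sum_nonneg fun x _ => ?_) (fun n => ?_)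
    (tendsto_expect_log_one_add hp hq0 hq (r := r) (by linarith))
  · exact mul_nonneg (iid_nonneg hp.1 n x) (Real.log_nonneg
      (by linarith [mul_nonneg (hm0 n) (iid_nonneg hq0 n x)]))
  · refine Finset.sum_le_sum fun x _ => mul_le_mul_of_nonneg_left ?_ (iid_nonneg hp.1 n x)
    have h1 := iid_nonneg hq0 n x
    have h2 := mul_nonneg (hm0 n) h1
    exact Real.log_le_log (by linarith) (by linarith [mul_le_mul_of_nonneg_right (hm n) h1])

end Limits

/-- A system of length `n` with rates at most `R + γ`, error at most `ε` and leakage at most `δ`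
exists. -/
def HasGoodSystem (ε δ : ℝ) (pX pK : A₁ × A₂ → ℝ) (R : ℝ × ℝ) (γ : ℝ) (n : ℕ) : Prop :=
  ∃ (E : Cryptosystem A₁ A₂ n) (S : SourceCode A₁ A₂ n), E.ActsAs S ∧
    1 / (n : ℝ) * Real.logb 2 E.C₁ ≤ R.1 + γ ∧ 1 / (n : ℝ) * Real.logb 2 E.C₂ ≤ R.2 + γ ∧
    S.errorProb pX ≤ ε ∧ E.leakage pX pK ≤ δ

section Direct

variable {pX pK : A₁ × A₂ → ℝ} (hX : pX ∈ stdSimplex ℝ (A₁ × A₂))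
  (hK : pK ∈ stdSimplex ℝ (A₁ × A₂)) {ε δ : ℝ} {R : ℝ × ℝ}
include hX hK

/-- A diagonal choice: at length `n` use the best `γ = 1 / (j + 1)`, `j ≤ n`, that works. -/
theorem isReliableSecure_of_hasGoodSystem
    (h : ∀ γ, 0 < γ → ∀ᶠ n in atTop, HasGoodSystem ε δ pX pK R γ n) :
    IsReliableSecure ε δ pX pK R := by
  classical
  have hex : ∀ n, ∃ (E : Cryptosystem A₁ A₂ n) (S : SourceCode A₁ A₂ n), E.ActsAs S ∧
      ∀ j ≤ n, HasGoodSystem ε δ pX pK R (1 / ((j : ℝ) + 1)) n →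
        1 / (n : ℝ) * Real.logb 2 E.C₁ ≤ R.1 + 1 / ((j : ℝ) + 1) ∧
        1 / (n : ℝ) * Real.logb 2 E.C₂ ≤ R.2 + 1 / ((j : ℝ) + 1) ∧
        S.errorProb pX ≤ ε ∧ E.leakage pX pK ≤ δ := by
    intro n
    by_cases hj : ∃ j ≤ n, HasGoodSystem ε δ pX pK R (1 / ((j : ℝ) + 1)) n
    · obtain ⟨j₀, hj₀, hg₀⟩ := hj
      have hk := Nat.findGreatest_spec
        (P := fun j => HasGoodSystem ε δ pX pK R (1 / ((j : ℝ) + 1)) n) hj₀ hg₀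
      obtain ⟨E, S, hES, h1, h2, h3, h4⟩ := hk
      refine ⟨E, S, hES, fun j hj hg => ?_⟩
      have hle := Nat.le_findGreatest
        (P := fun j => HasGoodSystem ε δ pX pK R (1 / ((j : ℝ) + 1)) n) hj hg
      have := Nat.one_div_le_one_div (α := ℝ) hle
      exact ⟨h1.trans (by linarith), h2.trans (by linarith), h3, h4⟩
    · obtain ⟨E, S, hES, -⟩ := exists_cryptosystem hX hK n 0 0
      exact ⟨E, S, hES, fun j hjn hg => absurd ⟨j, hjn, hg⟩ hj⟩
  choose E S hES hg using hex
  refine ⟨E, S, hES, fun γ hγ => ?_⟩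
  obtain ⟨j, hj⟩ := exists_nat_one_div_lt hγ
  obtain ⟨n₁, hn₁⟩ := eventually_atTop.1 (h (1 / ((j : ℝ) + 1)) (by positivity))
  refine ⟨max n₁ (max j 1), by omega, fun n hn => ?_⟩
  obtain ⟨h1, h2, h3, h4⟩ := hg n j (by omega) (hn₁ n (by omega))
  exact ⟨h1.trans (by linarith), h2.trans (by linarith), h3, h4⟩

omit hX hK in
lemma eventually_one_div_mul_logb_le {m : ℕ → ℕ} {r ρ : ℝ} (hr : 0 ≤ r) (hrρ : r < ρ)
    (hm : ∀ n, (m n : ℝ) ≤ ((2 : ℝ) ^ r) ^ n) :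
    ∀ᶠ n : ℕ in atTop, 1 / (n : ℝ) * Real.logb 2 ((m n + 1 : ℕ) : ℝ) ≤ ρ := by
  have ht := tendsto_one_div_atTop_nhds_zero_nat (𝕜 := ℝ)
  filter_upwards [ht.eventually_lt_const (sub_pos.2 hrρ), eventually_ge_atTop 1] with n hn hn1
  have hn0 : (0 : ℝ) < n := by exact_mod_cast hn1
  have h1 : (1 : ℝ) ≤ ((2 : ℝ) ^ r) ^ n :=
    one_le_pow₀ (Real.one_le_rpow one_le_two hr)
  have h2 : Real.logb 2 ((m n + 1 : ℕ) : ℝ) ≤ 1 + r * n := by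
    rw [Real.logb_le_iff_le_rpow one_lt_two (by positivity), Real.rpow_add two_pos, Real.rpow_one,
      Real.rpow_mul two_pos.le, Real.rpow_natCast]
    push_cast
    linarith [hm n]
  calc 1 / (n : ℝ) * Real.logb 2 ((m n + 1 : ℕ) : ℝ) ≤ 1 / (n : ℝ) * (1 + r * n) :=
        mul_le_mul_of_nonneg_left h2 (by positivity)
    _ = 1 / (n : ℝ) + r := by field_simp
    _ ≤ ρ := by linarith

omit hX hK in
lemma min_add_le {P a b : ℝ} (hP : 0 ≤ P) (ha : 0 ≤ a) (hb : 0 ≤ b) :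
    min P (a + b) ≤ min P a + min P b := by
  rcases min_choice P a with h | h <;> rcases min_choice P b with h' | h' <;> rw [h, h']
  · exact (min_le_left _ _).trans (by linarith)
  · exact (min_le_left _ _).trans (by linarith)
  · exact (min_le_left _ _).trans (by linarith)
  · exact min_le_right _ _

/-- Convergence to zero of the three error terms (the first, the second, or both components are
confused) and of the three leakage terms yields good systems. -/
theorem eventually_hasGoodSystem (hε : 0 < ε) (hδ : 0 < δ) {γ r₁ r₂ : ℝ} {m₁ m₂ : ℕ → ℕ}
    (hr₁ : 0 ≤ r₁) (hr₂ : 0 ≤ r₂) (hR₁ : r₁ < R.1 + γ) (hR₂ : r₂ < R.2 + γ)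
    (hm₁ : ∀ n, (m₁ n : ℝ) ≤ ((2 : ℝ) ^ r₁) ^ n) (hm₂ : ∀ n, (m₂ n : ℝ) ≤ ((2 : ℝ) ^ r₂) ^ n)
    (e₁ : Tendsto (fun n => ∑ x, min (iid pX n x)
      ((marg₂ (iid pX n) x.2 - iid pX n x) / ((m₁ n : ℝ) + 1))) atTop (𝓝 0))
    (e₂ : Tendsto (fun n => ∑ x, min (iid pX n x)
      ((marg₁ (iid pX n) x.1 - iid pX n x) / ((m₂ n : ℝ) + 1))) atTop (𝓝 0))
    (e₁₂ : Tendsto (fun n => ∑ x, min (iid pX n x)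
      ((1 - iid pX n x) / (((m₁ n : ℝ) + 1) * ((m₂ n : ℝ) + 1)))) atTop (𝓝 0))
    (k₁ : Tendsto (fun n => ∑ k, iid pK n k * Real.log (1 + m₁ n * iid (fun z => marg₁ pK z.1) n k))
      atTop (𝓝 0))
    (k₂ : Tendsto (fun n => ∑ k, iid pK n k * Real.log (1 + m₂ n * iid (fun z => marg₂ pK z.2) n k))
      atTop (𝓝 0))
    (k₁₂ : Tendsto (fun n => ∑ k, iid pK n k * Real.log (1 + (m₁ n * m₂ n) * iid pK n k))
      atTop (𝓝 0)) :
    ∀ᶠ n in atTop, HasGoodSystem ε δ pX pK R γ n := by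
  have hl : 0 < Real.log 2 := Real.log_pos one_lt_two
  have e := (e₁.add e₂).add e₁₂
  have k := (k₁.add k₂).add k₁₂
  rw [add_zero, add_zero] at e k
  filter_upwards [e.eventually_lt_const hε, k.eventually_lt_const (mul_pos hδ hl),
    eventually_one_div_mul_logb_le hr₁ hR₁ hm₁, eventually_one_div_mul_logb_le hr₂ hR₂ hm₂]
    with n hn₁ hn₂ hn₃ hn₄
  obtain ⟨E, S, hES, hC₁, hC₂, herr, hleak⟩ := exists_cryptosystem hX hK n (m₁ n) (m₂ n)
  refine ⟨E, S, hES, hC₁ ▸ hn₃, hC₂ ▸ hn₄, (herr.trans ?_).trans hn₁.le,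
    le_of_mul_le_mul_right ((hleak.trans ?_).trans hn₂.le) hl⟩
  · have hXn := iid_mem_stdSimplex hX n
    rw [← Finset.sum_add_distrib, ← Finset.sum_add_distrib]
    refine Finset.sum_le_sum fun x _ => ?_
    have h0 := hXn.1 x
    have h1 := le_marg₁ hXn.1 x
    have h2 := le_marg₂ hXn.1 x
    have h3 := le_one_of_mem_stdSimplex hXn x
    have d1 : 0 ≤ (marg₂ (iid pX n) x.2 - iid pX n x) / ((m₁ n : ℝ) + 1) :=
      div_nonneg (sub_nonneg.2 h2) (by positivity)
    have d2 : 0 ≤ (marg₁ (iid pX n) x.1 - iid pX n x) / ((m₂ n : ℝ) + 1) :=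
      div_nonneg (sub_nonneg.2 h1) (by positivity)
    have d3 : 0 ≤ (1 - iid pX n x) / (((m₁ n : ℝ) + 1) * ((m₂ n : ℝ) + 1)) :=
      div_nonneg (sub_nonneg.2 h3) (by positivity)
    refine le_trans ?_ ((min_add_le h0 (add_nonneg d1 d2) d3).trans
      (add_le_add_left (min_add_le h0 d1 d2) _))
    refine min_le_min_left _ ?_
    rw [meanBinMass, div_add_div _ _ (by positivity) (by positivity), ← add_div,
      div_sub' (by positivity)]
    refine div_le_div_of_nonneg_right ?_ (by positivity)
    nlinarith
  · have hKn := iid_mem_stdSimplex hK n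
    rw [← Finset.sum_add_distrib, ← Finset.sum_add_distrib]
    refine Finset.sum_le_sum fun x _ => ?_
    rw [← mul_add, ← mul_add]
    refine mul_le_mul_of_nonneg_left ?_ (hKn.1 x)
    have h0 := hKn.1 x
    have h1 := marg₁_nonneg hKn.1 x.1
    have h2 := marg₂_nonneg hKn.1 x.2
    rw [← marg₁_iid, ← marg₂_iid, ← Real.log_mul (by positivity) (by positivity),
      ← Real.log_mul (by positivity) (by positivity), meanBinMass]
    refine Real.log_le_log (by positivity) ?_
    set a := (m₁ n : ℝ) * marg₁ (iid pK n) x.1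
    set b := (m₂ n : ℝ) * marg₂ (iid pK n) x.2
    set c := (m₁ n : ℝ) * m₂ n * iid pK n x
    have ha : 0 ≤ a := by positivity
    have hb : 0 ≤ b := by positivity
    have hc : 0 ≤ c := by positivity
    nlinarith [mul_nonneg ha hb, mul_nonneg ha hc, mul_nonneg hb hc,
      mul_nonneg (mul_nonneg ha hb) hc]

end Direct

end

/-! ### Achievability of points of the sum-rate line -/

section

variable {A₁ A₂ : Type*} [Fintype A₁] [Fintype A₂]

section ErrorTerms

variable {p : A₁ × A₂ → ℝ} (hp : p ∈ stdSimplex ℝ (A₁ × A₂))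
include hp

/-- Confusion with words that differ in the first component only is unlikely at rates above
`H(first | second)`. -/
lemma tendsto_confusion₁ {r : ℝ} (hr : condEntropy₁ p < r) {N : ℕ → ℝ}
    (hN : ∀ n, ((2 : ℝ) ^ r) ^ n ≤ N n) :
    Tendsto (fun n => ∑ x, min (iid p n x) ((marg₂ (iid p n) x.2 - iid p n x) / N n))
      atTop (𝓝 0) := by
  refine tendsto_sum_min_zero_of_rate (q := fun z => marg₂ p z.2) hp (fun z => marg₂_nonneg hp.1 _)
    (fun z hz => marg₂_pos hp.1 hz) (r := r) ?_ hN
    (fun n x => sub_nonneg.2 (le_marg₂ (iid_mem_stdSimplex hp n).1 x)) fun n x => ?_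
  · refine lt_of_eq_of_lt ?_ hr
    rw [condEntropy₁, ← Finset.sum_neg_distrib]
    refine Finset.sum_congr rfl fun z _ => ?_
    rw [← inv_div, Real.logb_inv, mul_neg]
  · rw [← marg₂_iid]; linarith [iid_nonneg hp.1 n x]

lemma tendsto_confusion₂ {r : ℝ} (hr : condEntropy₂ p < r) {N : ℕ → ℝ}
    (hN : ∀ n, ((2 : ℝ) ^ r) ^ n ≤ N n) :
    Tendsto (fun n => ∑ x, min (iid p n x) ((marg₁ (iid p n) x.1 - iid p n x) / N n))
      atTop (𝓝 0) := by
  refine tendsto_sum_min_zero_of_rate (q := fun z => marg₁ p z.1) hp (fun z => marg₁_nonneg hp.1 _)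
    (fun z hz => marg₁_pos hp.1 hz) (r := r) ?_ hN
    (fun n x => sub_nonneg.2 (le_marg₁ (iid_mem_stdSimplex hp n).1 x)) fun n x => ?_
  · refine lt_of_eq_of_lt ?_ hr
    rw [condEntropy₂, ← Finset.sum_neg_distrib]
    refine Finset.sum_congr rfl fun z _ => ?_
    rw [← inv_div, Real.logb_inv, mul_neg]
  · rw [← marg₁_iid]; linarith [iid_nonneg hp.1 n x]

lemma tendsto_confusion₁₂ {r : ℝ} (hr : entropy p < r) {N : ℕ → ℝ}
    (hN : ∀ n, ((2 : ℝ) ^ r) ^ n ≤ N n) :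
    Tendsto (fun n => ∑ x, min (iid p n x) ((1 - iid p n x) / N n)) atTop (𝓝 0) := by
  refine tendsto_sum_min_zero_of_rate (q := fun _ => 1) hp (fun _ => zero_le_one)
    (fun _ _ => one_pos) (r := r) ?_ hN
    (fun n x => sub_nonneg.2 (le_one_of_mem_stdSimplex (iid_mem_stdSimplex hp n) x)) fun n x => ?_
  · refine lt_of_eq_of_lt ?_ hr
    rw [entropy, ← Finset.sum_neg_distrib]
    refine Finset.sum_congr rfl fun z _ => ?_
    rw [one_div, Real.logb_inv, mul_neg]
  · simpa [iid] using iid_nonneg hp.1 n x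

/-- If the second component determines the first, no words at all can be confused in the first
component only, even with a single bin. -/
lemma tendsto_confusion₁_of_condEntropy_eq_zero (h : condEntropy₁ p = 0) {N : ℕ → ℝ}
    (hN : ∀ n, 0 ≤ N n) :
    Tendsto (fun n => ∑ x, min (iid p n x) ((marg₂ (iid p n) x.2 - iid p n x) / N n))
      atTop (𝓝 0) := by
  refine tendsto_const_nhds.congr fun n => (sum_min_eq_zero hp
    (fun x => sub_nonneg.2 (le_marg₂ (iid_mem_stdSimplex hp n).1 x)) (fun x hx => ?_) _ (hN n)).symm
  rw [marg₂_iid, iid_eq_of_eq_on_support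
    (fun z hz => marg₂_eq_of_condEntropy₁_eq_zero hp.1 h hz) hx, sub_self]

lemma tendsto_confusion₂_of_condEntropy_eq_zero (h : condEntropy₂ p = 0) {N : ℕ → ℝ}
    (hN : ∀ n, 0 ≤ N n) :
    Tendsto (fun n => ∑ x, min (iid p n x) ((marg₁ (iid p n) x.1 - iid p n x) / N n))
      atTop (𝓝 0) := by
  refine tendsto_const_nhds.congr fun n => (sum_min_eq_zero hp
    (fun x => sub_nonneg.2 (le_marg₁ (iid_mem_stdSimplex hp n).1 x)) (fun x hx => ?_) _ (hN n)).symm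
  rw [marg₁_iid, iid_eq_of_eq_on_support
    (fun z hz => marg₁_eq_of_condEntropy₂_eq_zero hp.1 h hz) hx, sub_self]

lemma tendsto_confusion₁₂_of_entropy_eq_zero (h : entropy p = 0) {N : ℕ → ℝ}
    (hN : ∀ n, 0 ≤ N n) :
    Tendsto (fun n => ∑ x, min (iid p n x) ((1 - iid p n x) / N n)) atTop (𝓝 0) := by
  refine tendsto_const_nhds.congr fun n => (sum_min_eq_zero hp
    (fun x => sub_nonneg.2 (le_one_of_mem_stdSimplex (iid_mem_stdSimplex hp n) x))
    (fun x hx => ?_) _ (hN n)).symm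
  rw [iid_eq_of_eq_on_support (r := fun _ => 1)
    (fun z hz => eq_one_of_entropy_eq_zero hp h hz) hx]
  simp [iid]

lemma tendsto_leakage₁ {r : ℝ} (hr : r < entropy (marg₁ p)) {m : ℕ → ℝ} (hm0 : ∀ n, 0 ≤ m n)
    (hm : ∀ n, m n ≤ ((2 : ℝ) ^ r) ^ n) :
    Tendsto (fun n => ∑ x, iid p n x * Real.log (1 + m n * iid (fun z => marg₁ p z.1) n x))
      atTop (𝓝 0) :=
  tendsto_sum_mul_log_of_rate hp (fun z => marg₁_nonneg hp.1 _) (fun z hz => marg₁_pos hp.1 hz)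
    (by rwa [entropy_marg₁] at hr) hm0 hm

lemma tendsto_leakage₂ {r : ℝ} (hr : r < entropy (marg₂ p)) {m : ℕ → ℝ} (hm0 : ∀ n, 0 ≤ m n)
    (hm : ∀ n, m n ≤ ((2 : ℝ) ^ r) ^ n) :
    Tendsto (fun n => ∑ x, iid p n x * Real.log (1 + m n * iid (fun z => marg₂ p z.2) n x))
      atTop (𝓝 0) :=
  tendsto_sum_mul_log_of_rate hp (fun z => marg₂_nonneg hp.1 _) (fun z hz => marg₂_pos hp.1 hz)
    (by rwa [entropy_marg₂] at hr) hm0 hm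

lemma tendsto_leakage₁₂ {r : ℝ} (hr : r < entropy p) {m : ℕ → ℝ} (hm0 : ∀ n, 0 ≤ m n)
    (hm : ∀ n, m n ≤ ((2 : ℝ) ^ r) ^ n) :
    Tendsto (fun n => ∑ x, iid p n x * Real.log (1 + m n * iid p n x)) atTop (𝓝 0) :=
  tendsto_sum_mul_log_of_rate hp hp.1 (fun z hz => (hp.1 z).lt_of_ne' hz) hr hm0 hm

end ErrorTerms

/-- One less than the number of bins used at rate `r` and length `n`, so that this number is
`⌊2 ^ (r * n)⌋ + 1`. -/
noncomputable def binCount (r : ℝ) (n : ℕ) : ℕ := ⌊((2 : ℝ) ^ r) ^ n⌋₊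

lemma binCount_le (r : ℝ) (n : ℕ) : (binCount r n : ℝ) ≤ ((2 : ℝ) ^ r) ^ n :=
  Nat.floor_le (by positivity)

lemma le_binCount_add_one (r : ℝ) (n : ℕ) : ((2 : ℝ) ^ r) ^ n ≤ (binCount r n : ℝ) + 1 :=
  (Nat.lt_floor_add_one _).le

section Cases

variable {pX pK : A₁ × A₂ → ℝ} (hX : pX ∈ stdSimplex ℝ (A₁ × A₂))
  (hK : pK ∈ stdSimplex ℝ (A₁ × A₂)) {ε δ : ℝ} (hε : 0 < ε) (hδ : 0 < δ) {R : ℝ × ℝ} {γ : ℝ}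
include hX hK hε hδ

lemma eventually_hasGoodSystem_of_interior {r₁ r₂ : ℝ}
    (h₁ : condEntropy₁ pX < r₁) (h₂ : condEntropy₂ pX < r₂) (h₁₂ : entropy pX < r₁ + r₂)
    (k₁ : r₁ < entropy (marg₁ pK)) (k₂ : r₂ < entropy (marg₂ pK)) (k₁₂ : r₁ + r₂ < entropy pK)
    (hR₁ : r₁ < R.1 + γ) (hR₂ : r₂ < R.2 + γ) :
    ∀ᶠ n in atTop, HasGoodSystem ε δ pX pK R γ n := by
  refine eventually_hasGoodSystem hX hK hε hδ ((condEntropy₁_nonneg hX.1).trans h₁.le)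
    ((condEntropy₂_nonneg hX.1).trans h₂.le) hR₁ hR₂ (binCount_le r₁) (binCount_le r₂)
    (tendsto_confusion₁ hX h₁ (le_binCount_add_one r₁))
    (tendsto_confusion₂ hX h₂ (le_binCount_add_one r₂))
    (tendsto_confusion₁₂ hX h₁₂ fun n => ?_)
    (tendsto_leakage₁ hK k₁ (fun n => Nat.cast_nonneg _) (binCount_le r₁))
    (tendsto_leakage₂ hK k₂ (fun n => Nat.cast_nonneg _) (binCount_le r₂))
    (tendsto_leakage₁₂ hK k₁₂ (fun n => by positivity) fun n => ?_)
  · rw [← two_rpow_pow_mul]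
    exact mul_le_mul (le_binCount_add_one r₁ n) (le_binCount_add_one r₂ n) (by positivity)
      (by positivity)
  · rw [← two_rpow_pow_mul]
    exact mul_le_mul (binCount_le r₁ n) (binCount_le r₂ n) (by positivity) (by positivity)

lemma eventually_hasGoodSystem_of_condEntropy₁_eq_zero {r : ℝ} (h₁ : condEntropy₁ pX = 0)
    (h₂ : condEntropy₂ pX < r) (h₁₂ : entropy pX < r) (k₂ : r < entropy (marg₂ pK))
    (hR₁ : 0 < R.1 + γ) (hR₂ : r < R.2 + γ) :
    ∀ᶠ n in atTop, HasGoodSystem ε δ pX pK R γ n := by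
  refine eventually_hasGoodSystem hX hK hε hδ (m₁ := fun _ => 0) le_rfl
    ((condEntropy₂_nonneg hX.1).trans h₂.le) hR₁ hR₂ (fun n => by simp) (binCount_le r)
    (tendsto_confusion₁_of_condEntropy_eq_zero hX h₁ fun n => by positivity)
    (tendsto_confusion₂ hX h₂ (le_binCount_add_one r))
    (tendsto_confusion₁₂ hX h₁₂ fun n => ?_) (by simp)
    (tendsto_leakage₂ hK k₂ (fun n => Nat.cast_nonneg _) (binCount_le r)) (by simp)
  simpa using le_binCount_add_one r n

lemma eventually_hasGoodSystem_of_condEntropy₂_eq_zero {r : ℝ} (h₂ : condEntropy₂ pX = 0)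
    (h₁ : condEntropy₁ pX < r) (h₁₂ : entropy pX < r) (k₁ : r < entropy (marg₁ pK))
    (hR₁ : r < R.1 + γ) (hR₂ : 0 < R.2 + γ) :
    ∀ᶠ n in atTop, HasGoodSystem ε δ pX pK R γ n := by
  refine eventually_hasGoodSystem hX hK hε hδ (m₂ := fun _ => 0)
    ((condEntropy₁_nonneg hX.1).trans h₁.le) le_rfl hR₁ hR₂ (binCount_le r) (fun n => by simp)
    (tendsto_confusion₁ hX h₁ (le_binCount_add_one r))
    (tendsto_confusion₂_of_condEntropy_eq_zero hX h₂ fun n => by positivity)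
    (tendsto_confusion₁₂ hX h₁₂ fun n => ?_)
    (tendsto_leakage₁ hK k₁ (fun n => Nat.cast_nonneg _) (binCount_le r)) (by simp) (by simp)
  simpa using le_binCount_add_one r n

lemma eventually_hasGoodSystem_of_entropy_eq_zero (h₁ : condEntropy₁ pX = 0)
    (h₂ : condEntropy₂ pX = 0) (h₁₂ : entropy pX = 0) (hR₁ : 0 < R.1 + γ) (hR₂ : 0 < R.2 + γ) :
    ∀ᶠ n in atTop, HasGoodSystem ε δ pX pK R γ n :=
  eventually_hasGoodSystem hX hK hε hδ (m₁ := fun _ => 0) (m₂ := fun _ => 0) le_rfl le_rfl hR₁ hR₂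
    (fun n => by simp) (fun n => by simp)
    (tendsto_confusion₁_of_condEntropy_eq_zero hX h₁ fun n => by positivity)
    (tendsto_confusion₂_of_condEntropy_eq_zero hX h₂ fun n => by positivity)
    (tendsto_confusion₁₂_of_entropy_eq_zero hX h₁₂ fun n => by positivity)
    (by simp) (by simp) (by simp)

/-- Direct part. Off the excluded coincidences, `R` is approached by rate pairs in the interior of
both regions, unless some entropy vanishes; then the encoders concerned send nothing. -/
theorem isReliableSecure_of_mem (hsum : R.1 + R.2 = entropy pX) (hsw : R ∈ regionSW pX)
    (hkey : R ∈ regionKey pK)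
    (hne₁ : condEntropy₁ pX = entropy (marg₁ pK) → entropy (marg₁ pK) = 0)
    (hne₂ : condEntropy₂ pX = entropy (marg₂ pK) → entropy (marg₂ pK) = 0)
    (hne₁₂ : entropy pX = entropy pK → entropy pK = 0) :
    IsReliableSecure ε δ pX pK R := by
  obtain ⟨s₁, s₂, -⟩ := hsw
  obtain ⟨k₁, k₂, k₁₂⟩ := hkey
  have c₁ := condEntropy₁_nonneg hX.1
  have c₂ := condEntropy₂_nonneg hX.1
  have hsub := entropy_le_add hK
  refine isReliableSecure_of_hasGoodSystem hX hK fun γ hγ => ?_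
  rcases eq_or_ne (entropy pX) (entropy pK) with heq | hne
  · have h0 := hne₁₂ heq
    exact eventually_hasGoodSystem_of_entropy_eq_zero hX hK hε hδ (by linarith) (by linarith)
      (by linarith) (by linarith) (by linarith)
  have hlt : entropy pX < entropy pK := lt_of_le_of_ne (hsum ▸ k₁₂) hne
  rcases eq_or_ne (condEntropy₁ pX) (entropy (marg₁ pK)) with heq₁ | hne₁
  · have h0 := hne₁ heq₁
    obtain ⟨r, hr, hr'⟩ := exists_between
      (lt_min (show R.2 < entropy (marg₂ pK) by linarith) (show R.2 < R.2 + γ by linarith))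
    obtain ⟨hr₁, hr₂⟩ := lt_min_iff.1 hr'
    exact eventually_hasGoodSystem_of_condEntropy₁_eq_zero hX hK hε hδ (r := r) (by linarith)
      (by linarith) (by linarith) hr₁ (by linarith) hr₂
  rcases eq_or_ne (condEntropy₂ pX) (entropy (marg₂ pK)) with heq₂ | hne₂
  · have h0 := hne₂ heq₂
    obtain ⟨r, hr, hr'⟩ := exists_between
      (lt_min (show R.1 < entropy (marg₁ pK) by linarith) (show R.1 < R.1 + γ by linarith))
    obtain ⟨hr₁, hr₂⟩ := lt_min_iff.1 hr'
    exact eventually_hasGoodSystem_of_condEntropy₂_eq_zero hX hK hε hδ (r := r) (by linarith)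
      (by linarith) (by linarith) hr₁ hr₂ (by linarith)
  have l₁ : condEntropy₁ pX < entropy (marg₁ pK) := lt_of_le_of_ne (s₁.trans k₁) hne₁
  have l₂ : condEntropy₂ pX < entropy (marg₂ pK) := lt_of_le_of_ne (s₂.trans k₂) hne₂
  rcases k₁.eq_or_lt with hb₁ | hb₁
  · -- Here `R.2 < H(K₂)`, as `R.1 + R.2 < H(K₁ K₂) ≤ H(K₁) + H(K₂)`; so rate can be moved from
    -- the first encoder, whose key is used up, to the second.
    obtain ⟨η, hη, hη'⟩ := exists_between (lt_min (lt_min (sub_pos.2 l₁) (sub_pos.2 hlt))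
      (lt_min (show 0 < (entropy (marg₂ pK) - R.2) / 2 by linarith) (half_pos hγ)))
    simp only [lt_min_iff] at hη'
    obtain ⟨⟨e1, e2⟩, e3, e4⟩ := hη'
    exact eventually_hasGoodSystem_of_interior hX hK hε hδ (r₁ := R.1 - η) (r₂ := R.2 + 2 * η)
      (by linarith) (by linarith) (by linarith) (by linarith) (by linarith) (by linarith)
      (by linarith) (by linarith)
  rcases k₂.eq_or_lt with hb₂ | hb₂
  · obtain ⟨η, hη, hη'⟩ := exists_between (lt_min (lt_min (sub_pos.2 l₂) (sub_pos.2 hlt))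
      (lt_min (show 0 < (entropy (marg₁ pK) - R.1) / 2 by linarith) (half_pos hγ)))
    simp only [lt_min_iff] at hη'
    obtain ⟨⟨e1, e2⟩, e3, e4⟩ := hη'
    exact eventually_hasGoodSystem_of_interior hX hK hε hδ (r₁ := R.1 + 2 * η) (r₂ := R.2 - η)
      (by linarith) (by linarith) (by linarith) (by linarith) (by linarith) (by linarith)
      (by linarith) (by linarith)
  · obtain ⟨η, hη, hη'⟩ := exists_between (lt_min (lt_min (sub_pos.2 hb₁) (sub_pos.2 hb₂))
      (lt_min (show 0 < (entropy pK - entropy pX) / 2 by linarith) hγ))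
    simp only [lt_min_iff] at hη'
    obtain ⟨⟨e1, e2⟩, e3, e4⟩ := hη'
    exact eventually_hasGoodSystem_of_interior hX hK hε hδ (r₁ := R.1 + η) (r₂ := R.2 + η)
      (by linarith) (by linarith) (by linarith) (by linarith) (by linarith) (by linarith)
      (by linarith) (by linarith)

end Cases

/-! ### The sum-rate line -/

lemma sumSet_eq (pX pK : A₁ × A₂ → ℝ) : sumSet pX pK = sumSetSW pX ∩ regionKey pK := by
  ext R
  constructor
  · rintro ⟨⟨R', ⟨hkey, hsw⟩, h₁, h₂⟩, hsum⟩
    have h := hsw.2.2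
    have hsum' : R.1 + R.2 = entropy pX := hsum
    -- `R'` lies below `R`, and its sum rate is at least that of `R`.
    obtain rfl : R' = R := Prod.ext (by linarith) (by linarith)
    exact ⟨⟨hsw, hsum⟩, hkey⟩
  · rintro ⟨⟨hsw, hsum⟩, hkey⟩
    exact ⟨⟨R, ⟨hkey, hsw⟩, le_rfl, le_rfl⟩, hsum⟩

lemma sumSetStarAt_subset {pX pK : A₁ × A₂ → ℝ} (hX : pX ∈ stdSimplex ℝ (A₁ × A₂))
    (hK : pK ∈ stdSimplex ℝ (A₁ × A₂)) {ε : ℝ} (hε : ε < 1) (δ : ℝ) :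
    sumSetStarAt ε δ pX pK ⊆ sumSet pX pK := by
  rintro R ⟨hR, hsum⟩
  have hsum' : R.1 + R.2 = entropy pX := hsum
  rw [sumSet_eq]
  exact ⟨⟨⟨condEntropy₁_le_of_isReliableSecure hX hε hR,
    condEntropy₂_le_of_isReliableSecure hX hε hR, hsum'.ge⟩, hsum⟩,
    rate_le_entropy_marg₁_of_isReliableSecure hX hK hε hR hsum'.le,
    rate_le_entropy_marg₂_of_isReliableSecure hX hK hε hR hsum'.le,
    hsum'.le.trans (entropy_le_entropy_of_isReliableSecure hX hK hε hR)⟩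

end

end DistEnc

theorem theorem4 {A₁ A₂ : Type*} [Fintype A₁] [Fintype A₂]
    (pX pK : A₁ × A₂ → ℝ)
    (hX : pX ∈ stdSimplex ℝ (A₁ × A₂)) (hK : pK ∈ stdSimplex ℝ (A₁ × A₂))
    (δ₀ : ℝ) (hδ₀ : 0 < δ₀) :
    DistEnc.sumSet pX pK = DistEnc.sumSetSW pX ∩ DistEnc.regionKey pK ∧
    (∀ ε ∈ Set.Ioo (0 : ℝ) 1, ∀ δ ∈ Set.Icc (0 : ℝ) δ₀,
      DistEnc.sumSetStarAt ε δ pX pK ⊆ DistEnc.sumSet pX pK) ∧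
    DistEnc.sumSetStar δ₀ pX pK ⊆ DistEnc.sumSet pX pK ∧
    ((DistEnc.condEntropy₁ pX = DistEnc.entropy (DistEnc.marg₁ pK) →
        DistEnc.entropy (DistEnc.marg₁ pK) = 0) →
      (DistEnc.condEntropy₂ pX = DistEnc.entropy (DistEnc.marg₂ pK) →
        DistEnc.entropy (DistEnc.marg₂ pK) = 0) →
      (DistEnc.entropy pX = DistEnc.entropy pK → DistEnc.entropy pK = 0) →
      DistEnc.sumSet pX pK = DistEnc.sumSetStar δ₀ pX pK ∧
      ∀ ε ∈ Set.Ioo (0 : ℝ) 1, ∀ δ ∈ Set.Ioc (0 : ℝ) δ₀,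
        DistEnc.sumSet pX pK = DistEnc.sumSetStarAt ε δ pX pK) := by
  have hstarAt : ∀ ε < 1, ∀ δ, DistEnc.sumSetStarAt ε δ pX pK ⊆ DistEnc.sumSet pX pK :=
    fun ε hε δ => DistEnc.sumSetStarAt_subset hX hK hε δ
  have hstar : DistEnc.sumSetStar δ₀ pX pK ⊆ DistEnc.sumSet pX pK := fun R hR =>
    hstarAt (1 / 2) (by norm_num) δ₀
      ⟨hR.1 (1 / 2) ⟨by norm_num, by norm_num⟩ δ₀ ⟨hδ₀, le_rfl⟩, hR.2⟩
  refine ⟨DistEnc.sumSet_eq pX pK, fun ε hε δ _ => hstarAt ε hε.2 δ, hstar,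
    fun h₁ h₂ h₁₂ => ?_⟩
  have hdirect : ∀ R ∈ DistEnc.sumSet pX pK, ∀ ε, 0 < ε → ∀ δ, 0 < δ →
      R ∈ DistEnc.regionStarAt ε δ pX pK := by
    intro R hR ε hε δ hδ
    rw [DistEnc.sumSet_eq] at hR
    exact DistEnc.isReliableSecure_of_mem hX hK hε hδ hR.1.2 hR.1.1 hR.2 h₁ h₂ h₁₂
  exact ⟨Set.Subset.antisymm
      (fun R hR => ⟨fun ε hε δ hδ => hdirect R hR ε hε.1 δ hδ.1, hR.2⟩) hstar,
    fun ε hε δ hδ => Set.Subset.antisymm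
      (fun R hR => ⟨hdirect R hR ε hε.1 δ hδ.1, hR.2⟩) (hstarAt ε hε.2 δ)⟩
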